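/- Let $n\ge 2$, let $\mathbb K$ be $\mathbb R$ or $\mathbb C$, and let $f$ be a meromorphic function on $\mathbb K$ with values in $\mathbb K$ (for $\mathbb K=\mathbb R$: near each point, $f(x)=(x-x_0)^m g(x)$ for $x\neq x_0$, with $m\in\mathbb Z$ and $g$ real analytic at $x_0$). On the phase space of all $(x,p)\in\mathbb K^n\times\mathbb K^n$ such that $f$ is analytic at $x_j-x_k$ for all $j\ne k$, with the canonical Poisson bracket $\{F,G\}=\sum_j\big(\frac{\partial F}{\partial p_j}\frac{\partial G}{\partial x_j}-\frac{\partial F}{\partial x_j}\frac{\partial G}{\partial p_j}\big)$ (so that $\{p_i,x_j\}=\delta_{ij}$), consider $$H=\frac12\sum_{j=1}^n p_j^2\prod_{k\ne j}f(x_j-x_k),\qquad P=\sum_{j=1}^n p_j\prod_{k\ne j}f(x_j-x_k),\qquad B=\sum_{j=1}^n x_j .$$ For every constant $\lambda\in\mathbb K$ the relations $$\{H,B\}=P,\qquad \{P,B\}=\lambda,\qquad \{H,P\}=0$$ hold on this phase space if and only if $f$ is an even or an odd function and $$\sum_{j=1}^n\prod_{k\ne j}f(x_j-x_k)=\lambda$$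 for all such $x$. (Evenness and oddness are understood away from the singularities of $f$.) In particular, the following functions, over $\mathbb R$ as well as over $\mathbb C$, are odd, meromorphic, and satisfy the relations: 1. $f(x)=1/x$, with $\lambda=0$; 2. $f(x)=\coth x$, with $\lambda=1$ if $n$ is odd and $\lambda=0$ if $n$ is even; 3. if $n$ is even, $f(x)=\sqrt{\wp(x)-e_\alpha}$, with $\lambda=0$. Here $\wp$ is the Weierstrass function of any period lattice $L\subset\mathbb C$ and $e_\alpha=\wp(w)$ for any half-period $w$ ($2w\in L$, $w\notin L$); a square root of $\wp-e_\alpha$ that is meromorphic on $\mathbb C$ exists, and the claim holds for every such square root, and likewise for every meromorphic $f:\mathbb R\to\mathbb R$ with $f(x)^2=\wp(x)-e_\alpha$ for all real $x\notin L$. -/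

import Mathlib

/-! Functions on the phase space `𝕜ⁿ × 𝕜ⁿ` (with `𝕜 = ℝ` or `ℂ`) are written in curried form
`F x p`, with `x` the positions and `p` the momenta. -/

namespace GalileiModel

variable {𝕜 : Type*} [NontriviallyNormedField 𝕜] {n : ℕ}

/-- The partial derivative `∂F/∂x_j`. -/
noncomputable def partialX (j : Fin n) (F : (Fin n → 𝕜) → (Fin n → 𝕜) → 𝕜)
    (x p : Fin n → 𝕜) : 𝕜 :=
  deriv (fun t : 𝕜 => F (Function.update x j t) p) (x j)

/-- The partial derivative `∂F/∂p_j`. -/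
noncomputable def partialP (j : Fin n) (F : (Fin n → 𝕜) → (Fin n → 𝕜) → 𝕜)
    (x p : Fin n → 𝕜) : 𝕜 :=
  deriv (fun t : 𝕜 => F x (Function.update p j t)) (p j)

/-- The canonical Poisson bracket, normalised by `{p_i, x_j} = δ_{ij}`. -/
noncomputable def poisson (F G : (Fin n → 𝕜) → (Fin n → 𝕜) → 𝕜) (x p : Fin n → 𝕜) : 𝕜 :=
  ∑ j, (partialP j F x p * partialX j G x p - partialX j F x p * partialP j G x p)

/-- The product `∏_{k ≠ j} f (x_j - x_k)`. -/
noncomputable def weight (f : 𝕜 → 𝕜) (j : Fin n) (x : Fin n → 𝕜) : 𝕜 :=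
  ∏ k ∈ Finset.univ.erase j, f (x j - x k)

/-- The Hamiltonian `H = ½ ∑_j p_j² ∏_{k ≠ j} f (x_j - x_k)`. -/
noncomputable def hamiltonian (f : 𝕜 → 𝕜) (x p : Fin n → 𝕜) : 𝕜 :=
  (1 / 2) * ∑ j, p j ^ 2 * weight f j x

/-- The generator of translations `P = ∑_j p_j ∏_{k ≠ j} f (x_j - x_k)`. -/
noncomputable def momentum (f : 𝕜 → 𝕜) (x p : Fin n → 𝕜) : 𝕜 :=
  ∑ j, p j * weight f j x

/-- The generator of boosts `B = ∑_j x_j`. -/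
def boost (x _p : Fin n → 𝕜) : 𝕜 := ∑ j, x j

/-- The configurations at which `H` and `P` are regular: every difference `x_j - x_k`, `j ≠ k`,
avoids the singularities of `f`. -/
def configurations (n : ℕ) (f : 𝕜 → 𝕜) : Set (Fin n → 𝕜) :=
  {x | ∀ j k, j ≠ k → AnalyticAt 𝕜 f (x j - x k)}

/-- `{H, B} = P`, `{P, B} = c` and `{H, P} = 0` on the phase space of the `n`-particle model. -/
def SatisfiesAlgebra (n : ℕ) (f : 𝕜 → 𝕜) (c : 𝕜) : Prop :=
  ∀ x ∈ configurations n f, ∀ p : Fin n → 𝕜,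
    poisson (hamiltonian f) boost x p = momentum f x p ∧
    poisson (momentum f) boost x p = c ∧
    poisson (hamiltonian f) (momentum f) x p = 0

/-- Evenness of a meromorphic function. The placeholder values that a function `𝕜 → 𝕜` takes
at its singularities are ignored. -/
def IsEven (f : 𝕜 → 𝕜) : Prop :=
  ∀ z, AnalyticAt 𝕜 f z → AnalyticAt 𝕜 f (-z) → f (-z) = f z

/-- Oddness of a meromorphic function, again away from its singularities. -/
def IsOdd (f : 𝕜 → 𝕜) : Prop :=
  ∀ z, AnalyticAt 𝕜 f z → AnalyticAt 𝕜 f (-z) → f (-z) = -f z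

/-- `∑_j ∏_{k ≠ j} f (x_j - x_k) = c` identically. -/
def SumIdentity (n : ℕ) (f : 𝕜 → 𝕜) (c : 𝕜) : Prop :=
  ∀ x ∈ configurations n f, ∑ j, weight f j x = c

/-- `f` is an odd meromorphic function whose `n`-particle model obeys the algebra with
`{P, B} = c`. -/
def IsOddSolution (n : ℕ) (f : 𝕜 → 𝕜) (c : 𝕜) : Prop :=
  Meromorphic f ∧ IsOdd f ∧ SatisfiesAlgebra n f c

end GalileiModel

/-! Write `w_j` for the weights. `{H, B} = P` always holds and `{P, B} = ∑ w_j`, so everything turns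
on `{H, P}`, which is the quadratic form `∑ (p_j p_i - ½ p_i²) E_ji` with `E_ji = w_j ∂_j w_i`. Its
mixed coefficients `E_ji + E_ij` are multiples of `f(u) f'(-u) + f(-u) f'(u)`, `u = x_j - x_i`. Up
to the factor `-f(u)²` this is the derivative of `f(-u)/f(u)`, so its vanishing means `f(-u) = ε
f(u)`, and the leading Laurent term at `0` forces `ε = ±1`. Once the mixed terms vanish, the `p_i²`
terms vanish as well because `∑ w_i` is constant (`sum_quadratic_eq_zero`).

The sums for `1/x` and `coth` are leading coefficients in Lagrange interpolation, of `1` and of `∏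
(t + u_k)` with `u_k = exp(2 x_k)`.

For `√(℘ - e)` choose an index-two sublattice `M` of `L` containing `2w`, and `a` in the other
coset. The function `r = -½ ℘_M' / (℘_M - ℘_M(a))` is odd and `M`-periodic, changes sign under `z ↦
z + a`, and has at most simple poles, all on `L`. By Liouville `r² = ℘_L - ℘_L(w)` (`halfRoot_sq`).
For even `n`, `∑ w_j` built from `r` is an elliptic function of each `x_i` whose poles cancel, hence
constant; moving `x_i` by `a` changes its sign, so it is `0` (`sum_weight_halfRoot`). The identity
theorem shows that every other meromorphic root is a constant multiple of `r`. -/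

open Filter Topology

namespace GalileiModel

/-! ### Poisson brackets as quadratic forms in the momenta -/

section Brackets

variable {𝕜 : Type*} [NontriviallyNormedField 𝕜] {n : ℕ}

/-- The product `∏_{k ≠ i, j} f (x_i - x_k)`. -/
noncomputable def weightExcept (f : 𝕜 → 𝕜) (i j : Fin n) (x : Fin n → 𝕜) : 𝕜 :=
  ∏ k ∈ (Finset.univ.erase i).erase j, f (x i - x k)

lemma weight_eq_mul_weightExcept (f : 𝕜 → 𝕜) {i j : Fin n} (h : j ≠ i) (x : Fin n → 𝕜) :
    weight f i x = f (x i - x j) * weightExcept f i j x :=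
  (Finset.mul_prod_erase _ _ (by simpa using h)).symm

lemma weight_update_of_ne (f : 𝕜 → 𝕜) {i j : Fin n} (h : j ≠ i) (x : Fin n → 𝕜) (t : 𝕜) :
    weight f i (Function.update x j t) = f (x i - t) * weightExcept f i j x := by
  rw [weight_eq_mul_weightExcept f h, Function.update_self, Function.update_of_ne h.symm]
  congr 1
  refine Finset.prod_congr rfl fun k hk => ?_
  rw [Function.update_of_ne h.symm, Function.update_of_ne (Finset.ne_of_mem_erase hk)]

lemma weight_update_self (f : 𝕜 → 𝕜) (i : Fin n) (x : Fin n → 𝕜) (t : 𝕜) :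
    weight f i (Function.update x i t) = ∏ k ∈ Finset.univ.erase i, f (t - x k) := by
  refine Finset.prod_congr rfl fun k hk => ?_
  rw [Function.update_self, Function.update_of_ne (Finset.ne_of_mem_erase hk)]

/-- The partial derivative of the weight of particle `i` with respect to `x_j`. -/
noncomputable def weightDeriv (f : 𝕜 → 𝕜) (j i : Fin n) (x : Fin n → 𝕜) : 𝕜 :=
  deriv (fun t : 𝕜 => weight f i (Function.update x j t)) (x j)

lemma differentiableAt_update_apply (x : Fin n → 𝕜) (j i : Fin n) (t : 𝕜) :
    DifferentiableAt 𝕜 (fun t => Function.update x j t i) t :=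
  (hasDerivAt_pi.1 (hasDerivAt_update x j t) i).differentiableAt

lemma hasDerivAt_weight {f : 𝕜 → 𝕜} {x : Fin n → 𝕜} (hx : x ∈ configurations n f)
    (j i : Fin n) :
    HasDerivAt (fun t : 𝕜 => weight f i (Function.update x j t)) (weightDeriv f j i x) (x j) := by
  refine DifferentiableAt.hasDerivAt ?_
  unfold weight
  refine DifferentiableAt.fun_finsetProd fun k hk => ?_
  have h1 := differentiableAt_update_apply x j i (x j)
  have h2 := differentiableAt_update_apply x j k (x j)
  have h3 : DifferentiableAt 𝕜 f
      (Function.update x j (x j) i - Function.update x j (x j) k) := by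
    simpa using (hx i k (Finset.ne_of_mem_erase hk).symm).differentiableAt
  exact DifferentiableAt.comp (x j) (f := fun t => Function.update x j t i - Function.update x j t k)
    h3 (h1.sub h2)

lemma weightDeriv_of_ne {f : 𝕜 → 𝕜} {x : Fin n → 𝕜} {i j : Fin n} (h : j ≠ i) :
    weightDeriv f j i x = -deriv f (x i - x j) * weightExcept f i j x := by
  unfold weightDeriv
  simp_rw [weight_update_of_ne f h]
  rw [deriv_mul_const_field, deriv_comp_const_sub]

lemma partialP_momentum (f : 𝕜 → 𝕜) (j : Fin n) (x p : Fin n → 𝕜) :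
    partialP j (momentum f) x p = weight f j x := by
  have h := HasDerivAt.fun_sum (u := Finset.univ) fun i _ =>
    (hasDerivAt_pi.1 (hasDerivAt_update p j (p j)) i).mul_const (weight f i x)
  have h' := h.deriv
  unfold partialP momentum
  rw [h']
  simp [Pi.single_apply]

lemma partialX_boost (j : Fin n) (x p : Fin n → 𝕜) : partialX j boost x p = 1 := by
  have h := HasDerivAt.fun_sum (u := Finset.univ) fun i _ =>
    (hasDerivAt_pi.1 (hasDerivAt_update x j (x j)) i)
  have h' := h.deriv
  unfold partialX boost
  rw [h']
  simp

lemma partialP_boost (j : Fin n) (x p : Fin n → 𝕜) : partialP j boost x p = 0 := by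
  simp [partialP, boost]

lemma partialX_momentum {f : 𝕜 → 𝕜} {x : Fin n → 𝕜} (hx : x ∈ configurations n f)
    (j : Fin n) (p : Fin n → 𝕜) :
    partialX j (momentum f) x p = ∑ i, p i * weightDeriv f j i x :=
  (HasDerivAt.fun_sum fun i _ => (hasDerivAt_weight hx j i).const_mul (p i)).deriv

lemma partialX_hamiltonian {f : 𝕜 → 𝕜} {x : Fin n → 𝕜} (hx : x ∈ configurations n f)
    (j : Fin n) (p : Fin n → 𝕜) :
    partialX j (hamiltonian f) x p = (1 / 2) * ∑ i, p i ^ 2 * weightDeriv f j i x :=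
  ((HasDerivAt.fun_sum fun i _ => (hasDerivAt_weight hx j i).const_mul (p i ^ 2)).const_mul
    (1 / 2)).deriv

lemma partialP_hamiltonian [CharZero 𝕜] (f : 𝕜 → 𝕜) (j : Fin n) (x p : Fin n → 𝕜) :
    partialP j (hamiltonian f) x p = p j * weight f j x := by
  have h := (HasDerivAt.fun_sum (u := Finset.univ) fun i _ =>
    ((hasDerivAt_pi.1 (hasDerivAt_update p j (p j)) i).fun_pow 2).mul_const
      (weight f i x)).const_mul (1 / 2)
  have h' := h.deriv
  unfold partialP hamiltonian
  rw [h']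
  simp only [one_div, Nat.cast_ofNat, Nat.add_one_sub_one, pow_one, Pi.single_apply, mul_ite,
    mul_one, mul_zero, ite_mul, zero_mul, Finset.sum_ite_eq', Finset.mem_univ, if_true,
    Function.update_self]
  rw [mul_assoc, inv_mul_cancel_left₀ two_ne_zero]

lemma poisson_hamiltonian_boost [CharZero 𝕜] (f : 𝕜 → 𝕜) (x p : Fin n → 𝕜) :
    poisson (hamiltonian f) boost x p = momentum f x p := by
  simp [poisson, partialX_boost, partialP_boost, partialP_hamiltonian, momentum]

lemma poisson_momentum_boost (f : 𝕜 → 𝕜) (x p : Fin n → 𝕜) :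
    poisson (momentum f) boost x p = ∑ j, weight f j x := by
  simp [poisson, partialX_boost, partialP_boost, partialP_momentum]

lemma poisson_hamiltonian_momentum [CharZero 𝕜] {f : 𝕜 → 𝕜} {x : Fin n → 𝕜}
    (hx : x ∈ configurations n f) (p : Fin n → 𝕜) :
    poisson (hamiltonian f) (momentum f) x p =
      ∑ j, ∑ i, (p j * p i - (1 / 2) * p i ^ 2) * (weight f j x * weightDeriv f j i x) := by
  simp only [poisson, partialX_momentum hx, partialX_hamiltonian hx, partialP_momentum,
    partialP_hamiltonian]
  refine Finset.sum_congr rfl fun j _ => ?_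
  rw [Finset.mul_sum, Finset.mul_sum, Finset.sum_mul, ← Finset.sum_sub_distrib]
  exact Finset.sum_congr rfl fun i _ => by ring

/-- Only one factor of `w_i` involves `x_j`, and vice versa, so the remaining factors are common to
both terms. The last bracket is the numerator, up to sign, of the derivative of `f(-u)/f(u)`. -/
lemma weight_mul_weightDeriv_add_swap (f : 𝕜 → 𝕜) (x : Fin n → 𝕜) {i j : Fin n} (h : j ≠ i) :
    weight f j x * weightDeriv f j i x + weight f i x * weightDeriv f i j x =
      -(weightExcept f i j x * weightExcept f j i x) *
        (f (x j - x i) * deriv f (x i - x j) + f (x i - x j) * deriv f (x j - x i)) := by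
  rw [weightDeriv_of_ne h, weightDeriv_of_ne h.symm, weight_eq_mul_weightExcept f h,
    weight_eq_mul_weightExcept f h.symm]
  ring

/-- Off-diagonal antisymmetry and zero row sums give column sums `2 E_ii`, so the `½ p_i²` terms
cancel the diagonal of `∑ p_j p_i E_ji`; its off-diagonal part cancels in pairs. -/
lemma sum_quadratic_eq_zero [CharZero 𝕜] (E : Fin n → Fin n → 𝕜)
    (hE : ∀ i j, j ≠ i → E j i + E i j = 0) (hs : ∀ j, ∑ i, E j i = 0) (p : Fin n → 𝕜) :
    ∑ j, ∑ i, (p j * p i - (1 / 2) * p i ^ 2) * E j i = 0 := by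
  have hE' : ∀ i j, E j i + E i j = if j = i then 2 * E i i else 0 := by
    intro i j
    split_ifs with h
    · subst h; ring
    · exact hE i j h
  have h1 : (∑ j, ∑ i, p j * p i * E j i) * 2 = ∑ i, 2 * p i ^ 2 * E i i := by
    rw [mul_two]
    nth_rewrite 2 [Finset.sum_comm]
    simp_rw [← Finset.sum_add_distrib]
    refine Finset.sum_congr rfl fun j _ => ?_
    rw [← Finset.sum_subset (Finset.subset_univ {j})]
    · simp; ring
    · intro i _ hi
      have := hE i j (by simpa [eq_comm] using hi)
      linear_combination p j * p i * this
  have h2 : ∀ i, ∑ j, E j i = 2 * E i i := by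
    intro i
    have : ∑ j, (E j i + E i j) = 2 * E i i := by simp [hE']
    rw [Finset.sum_add_distrib, hs, add_zero] at this
    exact this
  have h3 : ∑ j, ∑ i, (1 / 2) * p i ^ 2 * E j i = ∑ i, p i ^ 2 * E i i := by
    rw [Finset.sum_comm]
    refine Finset.sum_congr rfl fun i _ => ?_
    rw [← Finset.mul_sum, h2]
    ring
  simp_rw [sub_mul, Finset.sum_sub_distrib]
  rw [h3]
  have h4 : ∑ i, 2 * p i ^ 2 * E i i = (∑ i, p i ^ 2 * E i i) * 2 := by
    rw [Finset.sum_mul]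
    exact Finset.sum_congr rfl fun i _ => by ring
  rw [h4] at h1
  rw [mul_right_cancel₀ two_ne_zero h1, sub_self]

lemma add_swap_eq_zero_of_sum_quadratic (E : Fin n → Fin n → 𝕜) {a b : Fin n} (hab : a ≠ b)
    (h : ∀ p : Fin n → 𝕜, ∑ j, ∑ i, (p j * p i - (1 / 2) * p i ^ 2) * E j i = 0) :
    E a b + E b a = 0 := by
  have h1 := h (Pi.single a 1)
  have h2 := h (Pi.single b 1)
  have h3 := h (Pi.single a 1 + Pi.single b 1)
  -- Polarisation: the form at `e_a + e_b` minus its values at `e_a` and at `e_b`.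
  have key : ∑ j, ∑ i, ((Pi.single a 1 : Fin n → 𝕜) j * (Pi.single b 1 : Fin n → 𝕜) i
      + (Pi.single b 1 : Fin n → 𝕜) j * (Pi.single a 1 : Fin n → 𝕜) i) * E j i = 0 := by
    rw [← sub_zero (0 : 𝕜), ← sub_zero (0 - 0 : 𝕜)]
    nth_rewrite 3 [← h2]
    nth_rewrite 2 [← h1]
    nth_rewrite 1 [← h3]
    simp_rw [← Finset.sum_sub_distrib]
    refine Finset.sum_congr rfl fun j _ => Finset.sum_congr rfl fun i _ => ?_
    have h0 : (Pi.single a 1 : Fin n → 𝕜) i * (Pi.single b 1 : Fin n → 𝕜) i = 0 := by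
      by_cases hi : i = a
      · subst hi; simp [hab]
      · simp [hi]
    simp only [Pi.add_apply]
    -- In characteristic two `1 / 2` is `0` by convention, and the square terms disappear.
    by_cases h20 : (2 : 𝕜) = 0
    · simp [h20]; ring
    · field_simp
      linear_combination E j i * 2 * h0
  simpa [Pi.single_apply, add_mul, Finset.sum_add_distrib] using key

end Brackets

/-! ### Parity of `f` and the characterisation -/

section Parity

variable {𝕜 : Type*} [RCLike 𝕜] {n : ℕ} {f : 𝕜 → 𝕜}

lemma isOpen_analyticAt_pair (f : 𝕜 → 𝕜) :
    IsOpen {z | AnalyticAt 𝕜 f z ∧ AnalyticAt 𝕜 f (-z)} :=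
  (isOpen_analyticAt 𝕜 f).inter ((isOpen_analyticAt 𝕜 f).preimage continuous_neg)

lemma mul_deriv_neg_add_eq_zero (hf : IsEven f ∨ IsOdd f) {z : 𝕜} (hz : AnalyticAt 𝕜 f z)
    (hz' : AnalyticAt 𝕜 f (-z)) : f z * deriv f (-z) + f (-z) * deriv f z = 0 := by
  have hev := (isOpen_analyticAt_pair f).mem_nhds (show z ∈ _ from ⟨hz, hz'⟩)
  have hd : deriv (fun w => f (-w)) z = -deriv f (-z) := deriv_comp_neg f z
  rcases hf with h | h
  · have h1 : (fun w => f (-w)) =ᶠ[𝓝 z] f := by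
      filter_upwards [hev] with w hw using h w hw.1 hw.2
    rw [h1.deriv_eq] at hd
    rw [h z hz hz']
    linear_combination f z * hd
  · have h1 : (fun w => f (-w)) =ᶠ[𝓝 z] fun w => -f w := by
      filter_upwards [hev] with w hw using h w hw.1 hw.2
    rw [h1.deriv_eq, deriv.fun_neg] at hd
    rw [h z hz hz']
    linear_combination f z * hd

lemma isOpen_configurations (n : ℕ) (f : 𝕜 → 𝕜) : IsOpen (configurations n f) := by
  simp only [configurations, Set.ofPred_forall]
  refine isOpen_iInter_of_finite fun j => isOpen_iInter_of_finite fun k =>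
    isOpen_iInter_of_finite fun _ => ?_
  exact (isOpen_analyticAt 𝕜 f).preimage (by fun_prop)

lemma sum_weightDeriv_eq_zero {c : 𝕜} (h : SumIdentity n f c) {x : Fin n → 𝕜}
    (hx : x ∈ configurations n f) (j : Fin n) : ∑ i, weightDeriv f j i x = 0 := by
  have h1 := HasDerivAt.fun_sum (u := Finset.univ) fun i _ => hasDerivAt_weight hx j i
  rw [← h1.deriv]
  have hc : Continuous fun t => Function.update x j t := continuous_const.update j continuous_id
  have h2 : (fun t => ∑ i, weight f i (Function.update x j t)) =ᶠ[𝓝 (x j)] fun _ => c := by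
    have := hc.continuousAt.preimage_mem_nhds
      ((isOpen_configurations n f).mem_nhds (show Function.update x j (x j) ∈ _ by simpa))
    filter_upwards [this] with t ht using h _ ht
  rw [h2.deriv_eq, deriv_const]

theorem satisfiesAlgebra_of_parity {c : 𝕜} (hf : IsEven f ∨ IsOdd f) (h : SumIdentity n f c) :
    SatisfiesAlgebra n f c := by
  intro x hx p
  refine ⟨poisson_hamiltonian_boost f x p, (poisson_momentum_boost f x p).trans (h x hx), ?_⟩
  rw [poisson_hamiltonian_momentum hx]
  refine sum_quadratic_eq_zero (fun j i => weight f j x * weightDeriv f j i x)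
    (fun i j hij => ?_) (fun j => ?_) p
  · rw [weight_mul_weightDeriv_add_swap f x hij]
    have h1 := hx j i hij
    have h2 := hx i j hij.symm
    have := mul_deriv_neg_add_eq_zero hf h1 (by simpa using h2)
    rw [neg_sub] at this
    rw [this, mul_zero]
  · rw [← Finset.mul_sum, sum_weightDeriv_eq_zero h hx, mul_zero]

/-- Identity theorem: a meromorphic function on `𝕜` which vanishes on a punctured neighbourhood of
one point vanishes wherever it is continuous. -/
lemma Meromorphic.eq_zero_of_eventually_eq_zero {E : Type*} [NormedAddCommGroup E]
    [NormedSpace 𝕜 E] [CompleteSpace E] {g : 𝕜 → E} (hg : Meromorphic g) {z₀ : 𝕜}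
    (h : ∀ᶠ z in 𝓝[≠] z₀, g z = 0) {z : 𝕜} (hz : ContinuousAt g z) : g z = 0 := by
  have h0 : meromorphicOrderAt g z = ⊤ := by
    by_contra hne
    have huniv : IsPreconnected (Set.univ : Set 𝕜) := (convex_univ (𝕜 := ℝ)).isPreconnected
    exact MeromorphicOn.meromorphicOrderAt_ne_top_of_isPreconnected
      (hg.meromorphicOn (s := Set.univ)) huniv (Set.mem_univ z) (Set.mem_univ z₀) hne
      (meromorphicOrderAt_eq_top_iff.2 h)
  have h1 := meromorphicOrderAt_eq_top_iff.1 h0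
  have h2 : Tendsto g (𝓝[≠] z) (𝓝 0) := tendsto_const_nhds.congr' (h1.mono fun _ h => h.symm)
  exact tendsto_nhds_unique (hz.tendsto.mono_left nhdsWithin_le_nhds) h2

lemma tendsto_neg_nhdsNE_zero : Tendsto (fun s : 𝕜 => -s) (𝓝[≠] 0) (𝓝[≠] 0) := by
  refine tendsto_nhdsWithin_of_tendsto_nhds_of_eventually_within _ ?_ ?_
  · have : Tendsto (fun s : 𝕜 => -s) (𝓝 0) (𝓝 0) := by
      simpa using (continuous_neg (G := 𝕜)).tendsto 0
    exact this.mono_left nhdsWithin_le_nhds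
  · filter_upwards [self_mem_nhdsWithin] with s hs
    simpa using hs

lemma Meromorphic.comp_neg {f : 𝕜 → 𝕜} (hf : Meromorphic f) : Meromorphic fun z => f (-z) :=
  fun z => (hf (-z)).comp_analyticAt (g := fun z => -z) (by fun_prop)

lemma parity_of_eventually (hf : Meromorphic f) {ε : 𝕜} (h : ∀ᶠ s in 𝓝[≠] 0, f (-s) = ε * f s)
    {z : 𝕜} (hz : AnalyticAt 𝕜 f z) (hz' : AnalyticAt 𝕜 f (-z)) : f (-z) = ε * f z := by
  have hm : Meromorphic ((fun z => f (-z)) - (fun _ => ε) * f) :=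
    (Meromorphic.comp_neg hf).sub ((Meromorphic.const ε).mul hf)
  have hc : ContinuousAt ((fun z => f (-z)) - (fun _ => ε) * f) z := by
    have h1 := hz.continuousAt
    have h2 : ContinuousAt (fun z => f (-z)) z := hz'.continuousAt.comp continuousAt_neg
    exact h2.sub (continuousAt_const.mul h1)
  have := Meromorphic.eq_zero_of_eventually_eq_zero hm (z₀ := 0)
    (by filter_upwards [h] with s hs; simp [hs]) hc
  exact sub_eq_zero.1 (by simpa using this)

/-- The relation says that `f(-s)/f(s)` has zero derivative. A punctured real interval is
disconnected, so constancy must be derived across `0`: writing `f = s^m g` with `g 0 ≠ 0`, the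
quotient extends analytically to `q = (-1)^m g(-s)/g(s)`, which is constant on a ball and equals
`(-1)^m` at `0`. -/
lemma exists_sign_of_mul_deriv_neg (hf : MeromorphicAt f 0)
    (hne : meromorphicOrderAt f 0 ≠ ⊤)
    (h : ∀ᶠ s in 𝓝[≠] 0, f s * deriv f (-s) + f (-s) * deriv f s = 0) :
    ∃ ε : 𝕜, (ε = 1 ∨ ε = -1) ∧ ∀ᶠ s in 𝓝[≠] 0, f (-s) = ε * f s := by
  obtain ⟨g, hg, hg0, hfg⟩ := (meromorphicOrderAt_ne_top_iff hf).1 hne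
  set m := (meromorphicOrderAt f 0).untop₀
  have hg' : AnalyticAt 𝕜 (fun s => g (-s)) 0 := by
    have : AnalyticAt 𝕜 g (-0) := by simpa
    exact this.comp (f := fun s : 𝕜 => -s) (by fun_prop)
  set q : 𝕜 → 𝕜 := fun s => (-1) ^ m * (g (-s) / g s) with hq
  have hqa : AnalyticAt 𝕜 q 0 := analyticAt_const.mul (hg'.div hg hg0)
  have hq0 : q 0 = (-1) ^ m := by simp [hq, hg0]
  have hfn : ∀ᶠ s in 𝓝[≠] 0, f s ≠ 0 :=
    (meromorphicOrderAt_ne_top_iff_eventually_ne_zero hf).1 hne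
  have han : ∀ᶠ s in 𝓝[≠] 0, AnalyticAt 𝕜 f s := hf.eventually_analyticAt
  have hgn : ∀ᶠ s in 𝓝[≠] 0, g s ≠ 0 :=
    (hg.continuousAt.eventually_ne hg0).filter_mono nhdsWithin_le_nhds
  have hfg' : ∀ᶠ s in 𝓝[≠] 0, f (-s) / f s = q s := by
    filter_upwards [hfg, tendsto_neg_nhdsNE_zero.eventually hfg, hgn, self_mem_nhdsWithin]
      with s h1 h2 h3 h4
    have h4' : s ≠ 0 := h4
    have h5 : s ^ m ≠ 0 := zpow_ne_zero _ h4'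
    rw [h1, h2, hq]
    simp only [sub_zero, smul_eq_mul]
    rw [show (-s) ^ m = (-1) ^ m * s ^ m by rw [← mul_zpow]; simp]
    field_simp
  have hdq : ∀ᶠ s in 𝓝[≠] 0, deriv q s = 0 := by
    filter_upwards [eventually_eventually_nhdsWithin.2 hfg', hfn, han,
      tendsto_neg_nhdsNE_zero.eventually han, h, self_mem_nhdsWithin] with s h1 h2 h3 h4 h5 h6
    have h1' : (fun s => f (-s) / f s) =ᶠ[𝓝 s] q := by
      rwa [nhdsWithin_eq_nhds.2 (isOpen_compl_singleton.mem_nhds h6)] at h1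
    rw [← h1'.deriv_eq]
    have hd : HasDerivAt (fun s => f (-s)) (-deriv f (-s)) s := by
      have := h4.differentiableAt.hasDerivAt.comp s (hasDerivAt_neg s)
      rw [mul_neg_one] at this
      exact this
    rw [(hd.fun_div h3.differentiableAt.hasDerivAt h2).deriv]
    rw [div_eq_zero_iff]
    left
    linear_combination -h5
  have hdq' : ∀ᶠ s in 𝓝 (0 : 𝕜), deriv q s = 0 := by
    have := hqa.deriv.frequently_zero_iff_eventually_zero.1 hdq.frequently
    exact this
  have hconst : ∀ᶠ s in 𝓝 (0 : 𝕜), q s = q 0 := by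
    obtain ⟨r, hr, hball⟩ := Metric.eventually_nhds_iff_ball.1
      (hdq'.and hqa.eventually_analyticAt)
    filter_upwards [Metric.ball_mem_nhds 0 hr] with s hs
    exact (convex_ball (0 : 𝕜) r).is_const_of_fderivWithin_eq_zero (𝕜 := 𝕜)
      (fun y hy => (hball y hy).2.differentiableAt.differentiableWithinAt)
      (fun y hy => by
        rw [fderivWithin_of_isOpen Metric.isOpen_ball hy]
        ext
        simpa using (hball y hy).1)
      hs (Metric.mem_ball_self hr)
  refine ⟨(-1) ^ m, (Int.even_or_odd m).imp Even.neg_one_zpow Odd.neg_one_zpow, ?_⟩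
  filter_upwards [hfg', hconst.filter_mono nhdsWithin_le_nhds, hfn] with s h1 h2 h3
  rw [← hq0, ← h2, ← h1, div_mul_cancel₀ _ h3]

theorem parity_of_satisfiesAlgebra (hn : 2 ≤ n) (hf : Meromorphic f) {c : 𝕜}
    (h : SatisfiesAlgebra n f c) : IsEven f ∨ IsOdd f := by
  -- Infinite order at `0` means that `f` vanishes at all its regular points.
  by_cases hne : meromorphicOrderAt f 0 = ⊤
  · left
    intro z hz hz'
    have := fun {w : 𝕜} (hw : AnalyticAt 𝕜 f w) => Meromorphic.eq_zero_of_eventually_eq_zero hf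
      (meromorphicOrderAt_eq_top_iff.1 hne) hw.continuousAt
    rw [this hz, this hz']
  have hgood : ∀ᶠ s in 𝓝[≠] (0 : 𝕜), AnalyticAt 𝕜 f s ∧ f s ≠ 0 :=
    (hf 0).eventually_analyticAt.and
      ((meromorphicOrderAt_ne_top_iff_eventually_ne_zero (hf 0)).1 hne)
  -- Equally spaced positions `x_j = j s`: for small `s ≠ 0` every weight factor is regular and
  -- nonzero, so it can be divided out, and particles `0` and `1` are at distance `s`.
  have hall : ∀ᶠ s in 𝓝[≠] (0 : 𝕜), ∀ j k : Fin n, j ≠ k →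
      AnalyticAt 𝕜 f ((j : ℕ) * s - (k : ℕ) * s) ∧ f ((j : ℕ) * s - (k : ℕ) * s) ≠ 0 := by
    simp only [eventually_all]
    intro j k hjk
    have hd : ((j : ℕ) : 𝕜) - (k : ℕ) ≠ 0 := by
      rw [sub_ne_zero]
      exact_mod_cast fun h => hjk (Fin.ext h)
    have ht : Tendsto (fun s : 𝕜 => (j : ℕ) * s - (k : ℕ) * s) (𝓝[≠] 0) (𝓝[≠] 0) := by
      refine tendsto_nhdsWithin_of_tendsto_nhds_of_eventually_within _ ?_ ?_
      · have : Tendsto (fun s : 𝕜 => (j : ℕ) * s - (k : ℕ) * s) (𝓝 0)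
            (𝓝 ((j : ℕ) * 0 - (k : ℕ) * 0)) := Continuous.tendsto (by fun_prop) 0
        simp only [mul_zero, sub_zero] at this
        exact this.mono_left nhdsWithin_le_nhds
      · filter_upwards [self_mem_nhdsWithin] with s hs
        rw [← sub_mul]
        exact mul_ne_zero hd hs
    exact ht.eventually hgood
  have hrel : ∀ᶠ s in 𝓝[≠] (0 : 𝕜), f s * deriv f (-s) + f (-s) * deriv f s = 0 := by
    filter_upwards [hall] with s hs
    set x : Fin n → 𝕜 := fun j => (j : ℕ) * s
    have hx : x ∈ configurations n f := fun j k hjk => (hs j k hjk).1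
    let a : Fin n := ⟨0, by omega⟩
    let b : Fin n := ⟨1, by omega⟩
    have hab : b ≠ a := by simp [a, b]
    have h1 := add_swap_eq_zero_of_sum_quadratic
      (fun j i => weight f j x * weightDeriv f j i x) hab
      (fun p => by rw [← poisson_hamiltonian_momentum hx]; exact (h x hx p).2.2)
    rw [weight_mul_weightDeriv_add_swap f x hab] at h1
    have hw : ∀ i j : Fin n, weightExcept f i j x ≠ 0 := fun i j =>
      Finset.prod_ne_zero_iff.2 fun k hk =>
        (hs i k (Finset.ne_of_mem_erase (Finset.mem_of_mem_erase hk)).symm).2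
    have h2 := (mul_eq_zero.1 h1).resolve_left (neg_ne_zero.2 (mul_ne_zero (hw _ _) (hw _ _)))
    simpa [x, a, b] using h2
  obtain ⟨ε, hε, hev⟩ := exists_sign_of_mul_deriv_neg (hf 0) hne hrel
  refine hε.imp (fun h1 z hz hz' => ?_) (fun h1 z hz hz' => ?_)
  · simpa [h1] using parity_of_eventually hf hev hz hz'
  · simpa [h1] using parity_of_eventually hf hev hz hz'

theorem satisfiesAlgebra_iff (hn : 2 ≤ n) (hf : Meromorphic f) (c : 𝕜) :
    SatisfiesAlgebra n f c ↔ (IsEven f ∨ IsOdd f) ∧ SumIdentity n f c :=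
  ⟨fun h => ⟨parity_of_satisfiesAlgebra hn hf h,
    fun x hx => (poisson_momentum_boost f x 0).symm.trans (h x hx 0).2.1⟩,
    fun h => satisfiesAlgebra_of_parity h.1 h.2⟩

end Parity

/-! ### Partial fraction identities from Lagrange interpolation -/

section Rational

variable {F : Type*} [Field F] {n : ℕ}

/-- The sum is the coefficient of `t^(n-1)` in the interpolation of the constant `1`, and `n - 1 >
0`. -/
lemma sum_prod_inv_sub_eq_zero (hn : 2 ≤ n) {x : Fin n → F} (hx : Function.Injective x) :
    ∑ j, ∏ k ∈ Finset.univ.erase j, 1 / (x j - x k) = 0 := by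
  have h := Lagrange.coeff_eq_sum (s := Finset.univ) (v := x) (P := 1) hx.injOn
    (by
      rw [Polynomial.degree_one, Finset.card_univ, Fintype.card_fin]
      exact_mod_cast (by omega : 0 < n))
  rw [Polynomial.coeff_one, if_neg (by simp; omega)] at h
  simp only [Polynomial.eval_one] at h
  rw [h]
  refine Finset.sum_congr rfl fun j _ => ?_
  rw [Finset.prod_div_distrib, Finset.prod_const_one]

/-- The partial fraction identity obtained by comparing leading coefficients in the Lagrange
interpolation of `∏ (t + u_k)` at the nodes `0, u_1, …, u_n`. -/
lemma two_mul_sum_prod_add_div_sub {u : Fin n → F} (hu : Function.Injective u)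
    (h0 : ∀ j, u j ≠ 0) :
    2 * ∑ j, ∏ k ∈ Finset.univ.erase j, (u j + u k) / (u j - u k) = 1 - (-1) ^ n := by
  set v : Option (Fin n) → F := fun o => o.elim 0 u
  have hv : Function.Injective v := by
    rintro (_ | i) (_ | j) hij
    · rfl
    · exact absurd hij.symm (h0 j)
    · exact absurd hij (h0 i)
    · exact congrArg some (hu hij)
  set P : Polynomial F := ∏ k, (Polynomial.X + Polynomial.C (u k)) with hP
  have hmon : P.Monic := Polynomial.monic_prod_of_monic _ _ fun k _ => Polynomial.monic_X_add_C _
  have hdeg : P.natDegree = n := by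
    rw [hP, Polynomial.natDegree_prod_of_monic _ _ fun k _ => Polynomial.monic_X_add_C _]
    simp
  have h := Lagrange.coeff_eq_sum (s := Finset.univ) (v := v) (P := P) hv.injOn
    (by
      rw [Polynomial.degree_eq_natDegree hmon.ne_zero, hdeg]
      simp only [Finset.card_univ, Fintype.card_option, Fintype.card_fin]
      exact_mod_cast n.lt_succ_self)
  have hc : P.coeff ((Finset.univ : Finset (Option (Fin n))).card - 1) = 1 := by
    simp only [Finset.card_univ, Fintype.card_option, Fintype.card_fin, Nat.add_sub_cancel]
    rw [← hdeg]
    exact hmon.coeff_natDegree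
  have hev : ∀ t, P.eval t = ∏ k, (t + u k) := fun t => by
    simp [hP, Polynomial.eval_prod]
  rw [hc, Fintype.sum_option] at h
  have hnone : P.eval (v none) / ∏ j ∈ Finset.univ.erase none, (v none - v j) = (-1) ^ n := by
    have h1 : (Finset.univ.erase (none : Option (Fin n))) =
        Finset.univ.map Function.Embedding.some := by
      ext o; cases o <;> simp
    rw [hev, h1, Finset.prod_map, ← Finset.prod_div_distrib]
    have : ∀ i : Fin n, (v none + u i) / (v none - v (Function.Embedding.some i)) = -1 := by
      intro i
      simp only [v, Option.elim, Function.Embedding.some_apply, zero_add, zero_sub]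
      rw [div_neg, div_self (h0 i)]
    rw [Finset.prod_congr rfl fun i _ => this i, Finset.prod_const, Finset.card_univ,
      Fintype.card_fin]
  -- The factor `u_j + u_j` of `P` over the factor `u_j - 0` from the extra node gives the `2`.
  have hsome : ∀ j, P.eval (v (some j)) / ∏ k ∈ Finset.univ.erase (some j), (v (some j) - v k) =
      2 * ∏ k ∈ Finset.univ.erase j, (u j + u k) / (u j - u k) := by
    intro j
    have h1 : (Finset.univ.erase (some j) : Finset (Option (Fin n))) =
        insert none ((Finset.univ.erase j).map Function.Embedding.some) := by
      ext o; cases o <;> simp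
    rw [hev, h1, Finset.prod_insert (by simp), Finset.prod_map, Finset.prod_div_distrib,
      ← Finset.mul_prod_erase _ _ (Finset.mem_univ j)]
    simp only [v, Option.elim, Function.Embedding.some_apply, sub_zero]
    have := h0 j
    rw [mul_div_mul_comm, ← two_mul, mul_div_assoc, div_self this, mul_one]
  rw [hnone] at h
  simp only [hsome] at h
  rw [← Finset.mul_sum] at h
  exact eq_sub_of_add_eq' h.symm

end Rational

/-! ### The solutions `1/x` and `coth x` -/

section Elementary

variable {𝕜 : Type*} [RCLike 𝕜] {n : ℕ}

/-- Division by zero yields a value at the pole, so regular configurations must be shown to avoid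
it: continuity would send `(c / s) * s` to `0`, yet it equals `c` off `z`. -/
lemma not_continuousAt_div {c s : 𝕜 → 𝕜} {s' z : 𝕜} (hc : ContinuousAt c z) (hcz : c z ≠ 0)
    (hs : HasDerivAt s s' z) (hs' : s' ≠ 0) (hsz : s z = 0) :
    ¬ ContinuousAt (fun w => c w / s w) z := by
  intro h
  have h1 : Tendsto (fun w => c w / s w * s w) (𝓝[≠] z) (𝓝 0) := by
    have := (h.mul hs.continuousAt).tendsto.mono_left (nhdsWithin_le_nhds (s := {z}ᶜ))
    rw [Pi.mul_apply, hsz, mul_zero] at this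
    exact this
  have h2 : Tendsto c (𝓝[≠] z) (𝓝 (c z)) := hc.tendsto.mono_left nhdsWithin_le_nhds
  have h3 : (fun w => c w / s w * s w) =ᶠ[𝓝[≠] z] c := by
    filter_upwards [hs.eventually_ne hs' (c := 0)] with w hw
    exact div_mul_cancel₀ _ hw
  exact hcz (tendsto_nhds_unique (h2.congr' h3.symm) h1)

lemma isOddSolution_of_odd {f : 𝕜 → 𝕜} {c : 𝕜} (hf : Meromorphic f) (ho : IsOdd f)
    (hs : SumIdentity n f c) : IsOddSolution n f c :=
  ⟨hf, ho, satisfiesAlgebra_of_parity (Or.inr ho) hs⟩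

lemma isOddSolution_inv (hn : 2 ≤ n) : IsOddSolution n (fun x : 𝕜 => 1 / x) 0 := by
  refine isOddSolution_of_odd ((Meromorphic.const 1).div fun x => analyticAt_id.meromorphicAt)
    (fun z _ _ => by rw [div_neg]) fun x hx => sum_prod_inv_sub_eq_zero hn fun j k hjk => ?_
  by_contra hne
  have h := (hx j k hne).continuousAt
  rw [hjk, sub_self] at h
  exact not_continuousAt_div (c := fun _ => 1) (s := fun w => w) continuousAt_const one_ne_zero
    (hasDerivAt_id' 0) one_ne_zero rfl h

lemma one_sub_neg_one_pow_div_two {F : Type*} [Field F] [CharZero F] (n : ℕ) {S : F}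
    (h : 2 * S = 1 - (-1) ^ n) : S = if Odd n then 1 else 0 := by
  split_ifs with hn
  · rw [hn.neg_one_pow] at h
    refine mul_left_cancel₀ (two_ne_zero (α := F)) ?_
    rw [h]; norm_num
  · rw [(Nat.not_odd_iff_even.1 hn).neg_one_pow, sub_self] at h
    exact (mul_eq_zero.1 h).resolve_left two_ne_zero

/-- If `c (x - y) / s (x - y) = (E x + E y) / (E x - E y)`, then `c / s` is a solution. -/
lemma isOddSolution_coth {c s E : 𝕜 → 𝕜} (hc : AnalyticOnNhd 𝕜 c Set.univ)
    (hs : ∀ z, HasDerivAt s (c z) z) (hsa : AnalyticOnNhd 𝕜 s Set.univ)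
    (hcs : ∀ z, c z ^ 2 - s z ^ 2 = 1) (hce : ∀ z, c (-z) = c z) (hso : ∀ z, s (-z) = -s z)
    (hE : ∀ z, E z ≠ 0)
    (h : ∀ x y, c (x - y) * (E x - E y) = s (x - y) * (E x + E y)) :
    IsOddSolution n (fun z => c z / s z) (if Odd n then 1 else 0) := by
  refine isOddSolution_of_odd (fun z => (hc z trivial).meromorphicAt.div (hsa z trivial).meromorphicAt)
    (fun z _ _ => by rw [hce, hso, div_neg]) fun x hx => ?_
  have hsne : ∀ j k, j ≠ k → s (x j - x k) ≠ 0 := by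
    intro j k hjk h0
    have hc0 : c (x j - x k) ≠ 0 := by
      intro h1
      have := hcs (x j - x k)
      rw [h0, h1] at this
      simp at this
    exact not_continuousAt_div (hc _ trivial).continuousAt hc0 (hs _) hc0 h0
      (hx j k hjk).continuousAt
  have hEne : ∀ j k, j ≠ k → E (x j) ≠ E (x k) := by
    intro j k hjk hEq
    have := h (x j) (x k)
    rw [hEq, sub_self, mul_zero, ← two_mul] at this
    exact mul_ne_zero (hsne j k hjk) (mul_ne_zero two_ne_zero (hE _)) this.symm
  refine one_sub_neg_one_pow_div_two n ?_
  rw [← two_mul_sum_prod_add_div_sub (u := fun j => E (x j))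
    (fun j k hjk => by_contra fun hne => hEne j k hne hjk) fun j => hE _]
  congr 1
  refine Finset.sum_congr rfl fun j _ => Finset.prod_congr rfl fun k hk => ?_
  have hjk := (Finset.ne_of_mem_erase hk).symm
  rw [div_eq_div_iff (hsne j k hjk) (sub_ne_zero.2 (hEne j k hjk)), h, mul_comm]

lemma isOddSolution_coth_real :
    IsOddSolution n (fun x : ℝ => Real.cosh x / Real.sinh x) (if Odd n then 1 else 0) := by
  refine isOddSolution_coth (E := fun x => Real.exp (2 * x)) (fun z _ => Real.analyticAt_cosh)
    Real.hasDerivAt_sinh (fun z _ => Real.analyticAt_sinh) Real.cosh_sq_sub_sinh_sq Real.cosh_neg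
    Real.sinh_neg (fun z => Real.exp_ne_zero _) fun x y => ?_
  rw [Real.cosh_eq, Real.sinh_eq]
  have h1 : Real.exp (x - y) * Real.exp (2 * y) = Real.exp (-(x - y)) * Real.exp (2 * x) := by
    rw [← Real.exp_add, ← Real.exp_add]; ring_nf
  linear_combination -h1

lemma isOddSolution_coth_complex :
    IsOddSolution n (fun x : ℂ => Complex.cosh x / Complex.sinh x) (if Odd n then 1 else 0) := by
  refine isOddSolution_coth (E := fun x => Complex.exp (2 * x))
    (fun z _ => Complex.analyticAt_cosh)
    Complex.hasDerivAt_sinh (fun z _ => Complex.analyticAt_sinh) Complex.cosh_sq_sub_sinh_sq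
    Complex.cosh_neg Complex.sinh_neg (fun z => Complex.exp_ne_zero _) fun x y => ?_
  rw [Complex.cosh, Complex.sinh]
  have h1 : Complex.exp (x - y) * Complex.exp (2 * y) =
      Complex.exp (-(x - y)) * Complex.exp (2 * x) := by
    rw [← Complex.exp_add, ← Complex.exp_add]; ring_nf
  linear_combination -h1

end Elementary

/-! ### Liouville's theorem and orders of vanishing -/

section Liouville

lemma tendsto_nhdsNE_of_injective {X Y : Type*} [TopologicalSpace X] [TopologicalSpace Y]
    {g : X → Y} {x : X} (hg : ContinuousAt g x) (hi : Function.Injective g) :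
    Tendsto g (𝓝[≠] x) (𝓝[≠] (g x)) :=
  tendsto_nhdsWithin_of_tendsto_nhds_of_eventually_within _
    (hg.tendsto.mono_left nhdsWithin_le_nhds)
    (by filter_upwards [self_mem_nhdsWithin] with s hs using hi.ne hs)

/-- Liouville's theorem: an elliptic function without poles is constant. -/
lemma exists_eq_const_of_periodic (L : PeriodPair) {F : ℂ → ℂ} (hF : Meromorphic F)
    (hord : ∀ z, 0 ≤ meromorphicOrderAt F z) (hper : ∀ z, ∀ l ∈ L.lattice, F (z + l) = F z) :
    ∃ c, ∀ z, ContinuousAt F z → F z = c := by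
  have hU : MeromorphicOn F Set.univ := hF.meromorphicOn
  set G := toMeromorphicNFOn F Set.univ
  have hGF : ∀ z, G =ᶠ[𝓝[≠] z] F := fun z => hU.toMeromorphicNFOn_eq_self_on_nhdsNE trivial
  -- The normal form repairs arbitrary values of `F` at removable singularities.
  have hG : ∀ z, AnalyticAt ℂ G z := fun z =>
    (MeromorphicNFAt.meromorphicOrderAt_nonneg_iff_analyticAt
      (meromorphicNFOn_toMeromorphicNFOn F Set.univ (Set.mem_univ z))).1
      (by rw [meromorphicOrderAt_congr (hGF z)]; exact hord z)
  have hGd : Differentiable ℂ G := fun z => (hG z).differentiableAt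
  have hlim : ∀ z, Tendsto F (𝓝[≠] z) (𝓝 (G z)) := fun z =>
    ((hG z).continuousAt.tendsto.mono_left nhdsWithin_le_nhds).congr' (hGF z)
  have hGper : ∀ z, ∀ l ∈ L.lattice, G (z + l) = G z := by
    intro z l hl
    have h1 : Tendsto (fun w => F (w + l)) (𝓝[≠] z) (𝓝 (G (z + l))) :=
      (hlim (z + l)).comp
        (tendsto_nhdsNE_of_injective (g := fun w => w + l) (by fun_prop) (add_left_injective l))
    simp only [hper _ l hl] at h1
    exact tendsto_nhds_unique h1 (hlim z)
  have hb := (IsZLattice.isCompact_range_of_periodic L.lattice G hGd.continuous hGper).isBounded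
  refine ⟨G 0, fun z hz => ?_⟩
  rw [← hGd.apply_eq_apply_of_bounded hb z 0]
  exact tendsto_nhds_unique (hz.tendsto.mono_left nhdsWithin_le_nhds) (hlim z)

lemma two_le_meromorphicOrderAt {f : ℂ → ℂ} {z : ℂ} (hf : AnalyticAt ℂ f z) (h0 : f z = 0)
    (h1 : deriv f z = 0) : 2 ≤ meromorphicOrderAt f z := by
  have h : ((2 : ℕ) : ℕ∞) ≤ analyticOrderAt f z :=
    (natCast_le_analyticOrderAt_iff_iteratedDeriv_eq_zero hf).2 fun i hi => by
      interval_cases i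
      · simpa using h0
      · simpa using h1
  rw [hf.meromorphicOrderAt_eq]
  cases hn : analyticOrderAt f z with
  | top => simp
  | coe m =>
    rw [hn] at h
    have : 2 ≤ m := by exact_mod_cast h
    rw [ENat.map_natCast]
    exact WithTop.coe_le_coe.2 (show (2 : ℤ) ≤ m by exact_mod_cast this)

lemma one_le_meromorphicOrderAt {f : ℂ → ℂ} {z : ℂ} (hf : AnalyticAt ℂ f z) (h0 : f z = 0) :
    1 ≤ meromorphicOrderAt f z := by
  have h : 1 ≤ analyticOrderAt f z := by
    rw [Order.one_le_iff_ne_zero]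
    exact hf.analyticOrderAt_ne_zero.2 h0
  rw [hf.meromorphicOrderAt_eq]
  cases hn : analyticOrderAt f z with
  | top => simp
  | coe m =>
    rw [hn] at h
    have : 1 ≤ m := by exact_mod_cast h
    rw [ENat.map_natCast]
    exact_mod_cast this

end Liouville

/-! ### The elliptic square root and its sum identity -/

section HalfPeriod

variable (M : PeriodPair) (a : ℂ)

lemma weierstrassP_add_mem {l : ℂ} (hl : l ∈ M.lattice) (z : ℂ) :
    M.weierstrassP (z + l) = M.weierstrassP z := M.weierstrassP_add_coe z ⟨l, hl⟩

lemma derivWeierstrassP_add_mem {l : ℂ} (hl : l ∈ M.lattice) (z : ℂ) :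
    M.derivWeierstrassP (z + l) = M.derivWeierstrassP z := M.derivWeierstrassP_add_coe z ⟨l, hl⟩

variable {M a}

/-- Since `w` and `-w` agree modulo the lattice, oddness gives `℘'(w) = -℘'(w)`. -/
lemma derivWeierstrassP_half_period {w : ℂ} (hw : 2 * w ∈ M.lattice) :
    M.derivWeierstrassP w = 0 := by
  have h := derivWeierstrassP_add_mem M hw (-w)
  rw [M.derivWeierstrassP_neg, show -w + 2 * w = w by ring] at h
  exact CharZero.eq_neg_self_iff.1 h

lemma analyticAt_weierstrassP {z : ℂ} (hz : z ∉ M.lattice) : AnalyticAt ℂ M.weierstrassP z :=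
  M.analyticOnNhd_weierstrassP z hz

variable (M a) in
/-- The difference `℘ - ℘(a)`. -/
noncomputable def weierstrassDiff (z : ℂ) : ℂ := M.weierstrassP z - M.weierstrassP a

lemma meromorphic_weierstrassDiff : Meromorphic (weierstrassDiff M a) :=
  M.meromorphic_weierstrassP.sub (Meromorphic.const _)

lemma deriv_weierstrassDiff : deriv (weierstrassDiff M a) = M.derivWeierstrassP := by
  funext z
  unfold weierstrassDiff
  rw [deriv_sub_const_fun, M.deriv_weierstrassP]

lemma analyticAt_weierstrassDiff {z : ℂ} (hz : z ∉ M.lattice) :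
    AnalyticAt ℂ (weierstrassDiff M a) z :=
  (analyticAt_weierstrassP hz).sub analyticAt_const

lemma order_weierstrassDiff {z : ℂ} (hz : z ∈ M.lattice) :
    meromorphicOrderAt (weierstrassDiff M a) z = -2 := by
  have h1 := M.order_weierstrassP z hz
  have h2 : 0 ≤ meromorphicOrderAt (fun _ : ℂ => -M.weierstrassP a) z :=
    analyticAt_const.meromorphicOrderAt_nonneg
  have h3 := meromorphicOrderAt_add_eq_left_of_lt (f₁ := M.weierstrassP)
    (f₂ := fun _ : ℂ => -M.weierstrassP a) (x := z) (MeromorphicAt.const _ _)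
    (by rw [h1]; exact lt_of_lt_of_le (by decide) h2)
  rw [h1] at h3
  exact h3

lemma order_weierstrassDiff_ne_top (z : ℂ) : meromorphicOrderAt (weierstrassDiff M a) z ≠ ⊤ :=
  MeromorphicOn.meromorphicOrderAt_ne_top_of_isPreconnected (x := 0)
    (meromorphic_weierstrassDiff.meromorphicOn (s := Set.univ))
    (convex_univ (𝕜 := ℝ)).isPreconnected (Set.mem_univ _) (Set.mem_univ z)
    (by rw [order_weierstrassDiff (zero_mem _)]; decide)

lemma two_le_order_weierstrassDiff (ha : a ∉ M.lattice) (h2a : 2 * a ∈ M.lattice) {z : ℂ}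
    (hz : z - a ∈ M.lattice) : 2 ≤ meromorphicOrderAt (weierstrassDiff M a) z := by
  have hzM : z ∉ M.lattice := fun h => ha (by simpa using sub_mem h hz)
  refine two_le_meromorphicOrderAt (analyticAt_weierstrassDiff hzM) ?_ ?_
  · have := weierstrassP_add_mem M hz a
    rw [add_sub_cancel] at this
    rw [weierstrassDiff, this, sub_self]
  · rw [deriv_weierstrassDiff]
    have := derivWeierstrassP_add_mem M hz a
    rw [add_sub_cancel] at this
    rw [this, derivWeierstrassP_half_period h2a]

/-- The addition formula for a half-period, `(℘(z) - e)(℘(z + a) - e) = k` with `e = ℘(a)`. -/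
lemma exists_weierstrassDiff_mul_add (ha : a ∉ M.lattice) (h2a : 2 * a ∈ M.lattice) :
    ∃ k ≠ 0, ∀ z ∉ M.lattice, z + a ∉ M.lattice →
      weierstrassDiff M a z * weierstrassDiff M a (z + a) = k := by
  have hm : Meromorphic (weierstrassDiff M a ∘ (· + a)) :=
    Meromorphic.meromorphic_comp_add_const_iff_meromorphic.2 meromorphic_weierstrassDiff
  set F : ℂ → ℂ := weierstrassDiff M a * (weierstrassDiff M a ∘ (· + a)) with hF
  have hFm : Meromorphic F := meromorphic_weierstrassDiff.mul hm
  have hFo : ∀ z, meromorphicOrderAt F z = meromorphicOrderAt (weierstrassDiff M a) z +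
      meromorphicOrderAt (weierstrassDiff M a) (z + a) := fun z => by
    rw [hF, meromorphicOrderAt_mul (meromorphic_weierstrassDiff z) (hm z),
      meromorphicOrderAt_comp_add_const_eq_meromorphicOrderAt]
  -- The double pole of either factor meets a double zero of the other.
  have hord : ∀ z, 0 ≤ meromorphicOrderAt F z := by
    intro z
    rw [hFo]
    by_cases hz : z ∈ M.lattice
    · rw [order_weierstrassDiff hz]
      calc (0 : WithTop ℤ) = -2 + 2 := rfl
        _ ≤ _ := by
          gcongr
          exact two_le_order_weierstrassDiff ha h2a (by simpa using hz)
    by_cases hza : z + a ∈ M.lattice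
    · rw [order_weierstrassDiff hza]
      calc (0 : WithTop ℤ) = 2 + -2 := rfl
        _ ≤ _ := by
          gcongr
          refine two_le_order_weierstrassDiff ha h2a ?_
          rw [show z - a = (z + a) - 2 * a by ring]
          exact sub_mem hza h2a
    · exact add_nonneg (analyticAt_weierstrassDiff hz).meromorphicOrderAt_nonneg
        (analyticAt_weierstrassDiff hza).meromorphicOrderAt_nonneg
  obtain ⟨k, hk⟩ := exists_eq_const_of_periodic M hFm hord (fun z l hl => by
    simp only [hF, Pi.mul_apply, Function.comp_apply, weierstrassDiff, add_right_comm z l a,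
      weierstrassP_add_mem M hl])
  refine ⟨k, ?_, fun z hz hza => ?_⟩
  · rintro rfl
    have h1 : meromorphicOrderAt F 0 = ⊤ := by
      rw [meromorphicOrderAt_eq_top_iff]
      filter_upwards [(hFm 0).eventually_analyticAt] with z hz using hk z hz.continuousAt
    rw [hFo, WithTop.add_eq_top] at h1
    exact h1.elim (order_weierstrassDiff_ne_top _) (order_weierstrassDiff_ne_top _)
  · refine hk z (ContinuousAt.mul (analyticAt_weierstrassDiff hz).continuousAt ?_)
    exact ContinuousAt.comp (f := (· + a)) (analyticAt_weierstrassDiff hza).continuousAt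
      (by fun_prop)

/-- `M` generates a sublattice of index two in the lattice of `L`, with `a` in the other coset. -/
structure IsIndexTwo (M L : PeriodPair) (a : ℂ) : Prop where
  le : M.lattice ≤ L.lattice
  mem : a ∈ L.lattice
  notMem : a ∉ M.lattice
  cover : ∀ l ∈ L.lattice, l ∈ M.lattice ∨ l - a ∈ M.lattice

lemma IsIndexTwo.two_mul_mem {L : PeriodPair} (h : IsIndexTwo M L a) : 2 * a ∈ M.lattice := by
  have h2 : 2 * a ∈ L.lattice := by rw [two_mul]; exact add_mem h.mem h.mem
  refine (h.cover _ h2).resolve_right fun h' => h.notMem ?_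
  rwa [two_mul, add_sub_cancel_right] at h'

variable (M a) in
/-- The odd elliptic function `-½ ℘' / (℘ - ℘(a))`, a square root of `℘ - e` for the lattice
generated by the periods of `℘` and by `a`. -/
noncomputable def halfRoot (z : ℂ) : ℂ :=
  -M.derivWeierstrassP z / (2 * weierstrassDiff M a z)

lemma meromorphic_halfRoot : Meromorphic (halfRoot M a) :=
  M.meromorphic_derivWeierstrassP.neg.div ((Meromorphic.const 2).mul meromorphic_weierstrassDiff)

lemma halfRoot_neg (z : ℂ) : halfRoot M a (-z) = -halfRoot M a z := by
  simp only [halfRoot, weierstrassDiff, M.weierstrassP_neg, M.derivWeierstrassP_neg, neg_div]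

lemma halfRoot_add_mem {l : ℂ} (hl : l ∈ M.lattice) (z : ℂ) :
    halfRoot M a (z + l) = halfRoot M a z := by
  simp only [halfRoot, weierstrassDiff, weierstrassP_add_mem M hl, derivWeierstrassP_add_mem M hl]

/-- `halfRoot` is `-½` times a logarithmic derivative, which has at most simple poles. -/
lemma neg_one_le_order_halfRoot (z : ℂ) : -1 ≤ meromorphicOrderAt (halfRoot M a) z := by
  have h : halfRoot M a = (fun _ => (-1 / 2 : ℂ)) * logDeriv (weierstrassDiff M a) := by
    funext w
    simp only [halfRoot, Pi.mul_apply, logDeriv_apply, deriv_weierstrassDiff]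
    rw [mul_comm (2 : ℂ), ← div_div]
    ring
  rw [h, meromorphicOrderAt_mul_of_ne_zero analyticAt_const (by norm_num)]
  by_cases h0 : meromorphicOrderAt (weierstrassDiff M a) z = 0
  · exact le_trans (by decide)
      (meromorphicOrderAt_logDeriv_nonneg (meromorphic_weierstrassDiff z) h0)
  · rw [meromorphicOrderAt_logDeriv_eq_neg_one (meromorphic_weierstrassDiff z) h0
      (order_weierstrassDiff_ne_top z)]

namespace IsIndexTwo

variable {L : PeriodPair} (h : IsIndexTwo M L a)
include h

lemma weierstrassDiff_ne_zero {z : ℂ} (hz : z ∉ L.lattice) : weierstrassDiff M a z ≠ 0 := by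
  obtain ⟨k, hk, hmul⟩ := exists_weierstrassDiff_mul_add h.notMem h.two_mul_mem
  have := hmul z (fun h' => hz (h.le h'))
    (fun h' => hz (by simpa using sub_mem (h.le h') h.mem))
  intro h0
  rw [h0, zero_mul] at this
  exact hk this.symm

lemma analyticAt_halfRoot {z : ℂ} (hz : z ∉ L.lattice) : AnalyticAt ℂ (halfRoot M a) z := by
  have hzM : z ∉ M.lattice := fun h' => hz (h.le h')
  exact (M.analyticOnNhd_derivWeierstrassP z hzM).neg.div
    (analyticAt_const.mul (analyticAt_weierstrassDiff hzM))
    (mul_ne_zero two_ne_zero (h.weierstrassDiff_ne_zero hz))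

/-- The product of `℘ - e` and its translate by `a` is constant, so their logarithmic derivatives
add up to zero. -/
lemma halfRoot_add {z : ℂ} (hz : z ∉ L.lattice) : halfRoot M a (z + a) = -halfRoot M a z := by
  have hza : z + a ∉ L.lattice := fun h' => hz (by simpa using sub_mem h' h.mem)
  have hzM : z ∉ M.lattice := fun h' => hz (h.le h')
  have hzaM : z + a ∉ M.lattice := fun h' => hza (h.le h')
  obtain ⟨k, -, hmul⟩ := exists_weierstrassDiff_mul_add h.notMem h.two_mul_mem
  have hev : (fun w => weierstrassDiff M a w * weierstrassDiff M a (w + a)) =ᶠ[𝓝 z]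
      fun _ => k := by
    filter_upwards [L.isClosed_lattice.isOpen_compl.mem_nhds hz] with w hw
    exact hmul w (fun h' => hw (h.le h')) (fun h' => hw (by simpa using sub_mem (h.le h') h.mem))
  have h1 : HasDerivAt (weierstrassDiff M a) (M.derivWeierstrassP z) z := by
    rw [← deriv_weierstrassDiff (a := a)]
    exact (analyticAt_weierstrassDiff hzM).differentiableAt.hasDerivAt
  have h2 : HasDerivAt (weierstrassDiff M a) (M.derivWeierstrassP (z + a)) (z + a) := by
    rw [← deriv_weierstrassDiff (a := a)]
    exact (analyticAt_weierstrassDiff hzaM).differentiableAt.hasDerivAt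
  have h3 := (h1.fun_mul (h2.comp_add_const z a)).deriv
  rw [hev.deriv_eq, deriv_const] at h3
  have n1 := h.weierstrassDiff_ne_zero hz
  have n2 := h.weierstrassDiff_ne_zero hza
  unfold halfRoot
  rw [neg_div, neg_div, neg_neg, neg_eq_iff_add_eq_zero,
    div_add_div _ _ (mul_ne_zero two_ne_zero n2) (mul_ne_zero two_ne_zero n1), div_eq_zero_iff]
  left
  linear_combination -2 * h3

lemma exists_sign {l : ℂ} (hl : l ∈ L.lattice) :
    ∃ ε : ℂ, (ε = 1 ∨ ε = -1) ∧ ∀ z ∉ L.lattice, halfRoot M a (z + l) = ε * halfRoot M a z := by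
  rcases h.cover l hl with h' | h'
  · exact ⟨1, Or.inl rfl, fun z _ => by rw [halfRoot_add_mem h', one_mul]⟩
  · refine ⟨-1, Or.inr rfl, fun z hz => ?_⟩
    have := halfRoot_add_mem (a := a) h' (z + a)
    rw [add_assoc, add_sub_cancel] at this
    rw [this, h.halfRoot_add hz, neg_one_mul]

end IsIndexTwo

lemma eventually_notMem_lattice (L : PeriodPair) (z : ℂ) : ∀ᶠ w in 𝓝[≠] z, w ∉ L.lattice := by
  filter_upwards [nhdsWithin_le_nhds (L.compl_lattice_sdiff_singleton_mem_nhds z),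
    self_mem_nhdsWithin] with w h1 h2 h3
  exact h1 ⟨h3, h2⟩

/-- Near the origin the double poles of `halfRoot ^ 2` and of `℘` cancel. -/
lemma order_halfRoot_sq_sub_zero (L : PeriodPair) :
    0 ≤ meromorphicOrderAt (fun z => halfRoot M a z ^ 2 - L.weierstrassP z) 0 := by
  set e := M.weierstrassP a
  have hp := M.analyticAt_weierstrassPExcept 0
  have hd := M.analyticAt_derivWeierstrassPExcept 0
  have hL := L.analyticAt_weierstrassPExcept 0
  set p := M.weierstrassPExcept 0
  set d := M.derivWeierstrassPExcept 0
  set pL := L.weierstrassPExcept 0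
  have hD : AnalyticAt ℂ (fun z => 1 + z ^ 2 * (p z - e)) 0 := by fun_prop
  have hD0 : (1 : ℂ) + 0 ^ 2 * (p 0 - e) ≠ 0 := by norm_num
  -- With `℘_M = p + z⁻²`, `℘_M' = d - 2 z⁻³` and `D = 1 + z² (p - e)`, the root is `(2 - z³ d) / (2
  -- z D)`; this is its square minus `z⁻² + pL`, after cancelling `z²`.
  have hG : AnalyticAt ℂ (fun z => (-z * d z + z ^ 4 * d z ^ 2 / 4 - 2 * (p z - e) -
      z ^ 2 * (p z - e) ^ 2) / (1 + z ^ 2 * (p z - e)) ^ 2 - pL z) 0 := by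
    refine AnalyticAt.sub (AnalyticAt.div ?_ (hD.pow 2) (pow_ne_zero 2 hD0)) hL
    fun_prop
  refine ((Meromorphic.sub (meromorphic_halfRoot.pow (n := 2))
    L.meromorphic_weierstrassP) 0).meromorphicOrderAt_nonneg_iff.2 ⟨_, hG, ?_⟩
  filter_upwards [self_mem_nhdsWithin,
    (hD.continuousAt.eventually_ne hD0).filter_mono nhdsWithin_le_nhds] with z hz hDz
  have hz' : z ≠ 0 := hz
  have e1 : M.weierstrassP z = p z + 1 / z ^ 2 := by
    have := M.weierstrassPExcept_add 0 z
    simpa using this.symm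
  have e2 : L.weierstrassP z = pL z + 1 / z ^ 2 := by
    have := L.weierstrassPExcept_add 0 z
    simpa using this.symm
  have e3 : M.derivWeierstrassP z = d z - 2 / z ^ 3 := by
    have := M.derivWeierstrassPExcept_sub 0 z
    simpa using this.symm
  have hroot : halfRoot M a z = (2 - z ^ 3 * d z) / (2 * z * (1 + z ^ 2 * (p z - e))) := by
    have hq : weierstrassDiff M a z = (1 + z ^ 2 * (p z - e)) / z ^ 2 := by
      rw [weierstrassDiff, e1]
      field_simp
      ring
    rw [halfRoot, hq, e3]
    field_simp
    ring
  simp only [Pi.sub_apply, Pi.pow_apply]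
  rw [hroot, e2]
  set D := 1 + z ^ 2 * (p z - e) with hDdef
  have hpe : p z - e = (D - 1) / z ^ 2 := by rw [hDdef]; field_simp; ring
  rw [hpe]
  field_simp
  ring

namespace IsIndexTwo

variable {L : PeriodPair} (h : IsIndexTwo M L a)
include h

/-- Squaring removes the sign under `L`-translations, so only the origin needs checking for poles of
`halfRoot ^ 2 - ℘_L`. The Liouville constant is read off at `w`, where `halfRoot` vanishes because
`2w ∈ M`. -/
lemma halfRoot_sq {w : ℂ} (hw : w ∉ L.lattice) (h2w : 2 * w ∈ M.lattice) {z : ℂ}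
    (hz : z ∉ L.lattice) : halfRoot M a z ^ 2 = L.weierstrassP z - L.weierstrassP w := by
  set F : ℂ → ℂ := fun z => halfRoot M a z ^ 2 - L.weierstrassP z with hF
  have hFm : Meromorphic F :=
    Meromorphic.sub (meromorphic_halfRoot.pow (n := 2)) L.meromorphic_weierstrassP
  have hFa : ∀ z ∉ L.lattice, AnalyticAt ℂ F z := fun z hz =>
    ((h.analyticAt_halfRoot hz).pow 2).sub (analyticAt_weierstrassP hz)
  have hord : ∀ z, 0 ≤ meromorphicOrderAt F z := by
    intro z
    by_cases hz : z ∈ L.lattice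
    · have h1 : meromorphicOrderAt (F ∘ (· + z)) 0 = meromorphicOrderAt F z := by
        rw [meromorphicOrderAt_comp_add_const_eq_meromorphicOrderAt, zero_add]
      rw [← h1]
      refine (order_halfRoot_sq_sub_zero (M := M) (a := a) L).trans_eq
        (meromorphicOrderAt_congr ?_)
      obtain ⟨ε, hε, hsign⟩ := h.exists_sign hz
      filter_upwards [eventually_notMem_lattice L 0] with u hu
      simp only [hF, Function.comp_apply, hsign u hu, weierstrassP_add_mem L hz]
      rcases hε with rfl | rfl <;> ring
    · exact (hFa z hz).meromorphicOrderAt_nonneg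
  obtain ⟨c, hc⟩ := exists_eq_const_of_periodic M hFm hord (fun z l hl => by
    simp only [hF, halfRoot_add_mem hl, weierstrassP_add_mem L (h.le hl)])
  have h1 := hc z (hFa z hz).continuousAt
  have h2 := hc w (hFa w hw).continuousAt
  have h3 : halfRoot M a w = 0 := by
    rw [halfRoot, derivWeierstrassP_half_period h2w, neg_zero, zero_div]
  simp only [hF] at h1 h2
  rw [h3] at h2
  linear_combination h1 - h2

variable {n : ℕ}

/-- A pole in `z = x_i` can only occur at `x_k + L`. There, by oddness, the terms of particles `i`
and `k` combine to `f(z - x_k)` times a bracket that vanishes at `z₀`, cancelling the simple pole.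
-/
lemma order_sum_weight_nonneg (hn : Even n) {x : Fin n → ℂ} {i : Fin n}
    (hx : ∀ j k, j ≠ k → j ≠ i → k ≠ i → x j - x k ∉ L.lattice) (z₀ : ℂ) :
    0 ≤ meromorphicOrderAt
      (fun z => ∑ j, weight (halfRoot M a) j (Function.update x i z)) z₀ := by
  set f := halfRoot M a
  have hfa : ∀ k, z₀ - x k ∉ L.lattice → AnalyticAt ℂ (fun z => f (z - x k)) z₀ := fun k hk =>
    AnalyticAt.fun_comp (h.analyticAt_halfRoot hk) (by fun_prop)
  have hfa' : ∀ k, z₀ - x k ∉ L.lattice → AnalyticAt ℂ (fun z => f (x k - z)) z₀ := fun k hk =>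
    AnalyticAt.fun_comp (f := fun z => x k - z)
      (h.analyticAt_halfRoot (by rwa [← neg_sub, neg_mem_iff])) (by fun_prop)
  have hS : (fun z => ∑ j, weight f j (Function.update x i z)) = fun z =>
      ∏ k ∈ Finset.univ.erase i, f (z - x k) +
        ∑ j ∈ Finset.univ.erase i, f (x j - z) * weightExcept f j i x := by
    funext z
    rw [← Finset.add_sum_erase _ _ (Finset.mem_univ i), weight_update_self]
    congr 1
    exact Finset.sum_congr rfl fun j hj => weight_update_of_ne f (Finset.ne_of_mem_erase hj).symm _ _
  rw [hS]
  by_cases hA : ∀ k, k ≠ i → z₀ - x k ∉ L.lattice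
  · refine AnalyticAt.meromorphicOrderAt_nonneg (AnalyticAt.add ?_ ?_)
    · exact Finset.analyticAt_fun_prod _ fun k hk => hfa k (hA k (Finset.ne_of_mem_erase hk))
    · exact Finset.analyticAt_fun_sum _ fun k hk =>
        (hfa' k (hA k (Finset.ne_of_mem_erase hk))).mul analyticAt_const
  push Not at hA
  obtain ⟨k, hki, hk⟩ := hA
  have hother : ∀ l ∈ (Finset.univ.erase i).erase k, x k - x l ∉ L.lattice := fun l hl =>
    hx k l (Finset.ne_of_mem_erase hl).symm hki (Finset.ne_of_mem_erase (Finset.mem_of_mem_erase hl))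
  have hother' : ∀ l ∈ (Finset.univ.erase i).erase k, z₀ - x l ∉ L.lattice := fun l hl hmem =>
    hother l hl (by
      rw [show x k - x l = (z₀ - x l) - (z₀ - x k) by ring]
      exact sub_mem hmem hk)
  have hkmem : k ∈ Finset.univ.erase i := by simpa using hki
  have hS2 : (fun z => ∏ k ∈ Finset.univ.erase i, f (z - x k) +
        ∑ j ∈ Finset.univ.erase i, f (x j - z) * weightExcept f j i x) =
      (f ∘ (· - x k)) * (fun z => ∏ l ∈ (Finset.univ.erase i).erase k, f (z - x l) -
        weightExcept f k i x) +
      fun z => ∑ j ∈ (Finset.univ.erase i).erase k, f (x j - z) * weightExcept f j i x := by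
    funext z
    simp only [Pi.add_apply, Pi.mul_apply, Function.comp_apply]
    rw [← Finset.mul_prod_erase _ _ hkmem, ← Finset.add_sum_erase _ _ hkmem,
      show x k - z = -(z - x k) by ring, show f (-(z - x k)) = -f (z - x k) from halfRoot_neg _]
    ring
  have hprod : AnalyticAt ℂ (fun z => ∏ l ∈ (Finset.univ.erase i).erase k, f (z - x l) -
        weightExcept f k i x) z₀ :=
    (Finset.analyticAt_fun_prod _ fun l hl => hfa l (hother' l hl)).sub analyticAt_const
  -- Translating by `z₀ - x_k ∈ L` multiplies each of the `n - 2` factors by `ε = ±1`; here `n` even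
  -- is used.
  have hval : ∏ l ∈ (Finset.univ.erase i).erase k, f (z₀ - x l) - weightExcept f k i x = 0 := by
    obtain ⟨ε, hε, hsign⟩ := h.exists_sign hk
    rw [weightExcept, Finset.erase_right_comm (a := k), sub_eq_zero]
    have : ∀ l ∈ (Finset.univ.erase i).erase k, f (z₀ - x l) = ε * f (x k - x l) := fun l hl => by
      rw [← hsign _ (hother l hl)]
      congr 1
      ring
    rw [Finset.prod_congr rfl this, Finset.prod_mul_distrib, Finset.prod_const,
      Finset.card_erase_of_mem hkmem, Finset.card_erase_of_mem (Finset.mem_univ i),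
      Finset.card_univ, Fintype.card_fin]
    have hev : Even (n - 1 - 1) := by
      obtain ⟨m, rfl⟩ := hn
      exact ⟨m - 1, by omega⟩
    have : ε ^ (n - 1 - 1) = 1 := by
      rcases hε with rfl | rfl
      · exact one_pow _
      · exact hev.neg_one_pow
    rw [this, one_mul]
  have hfm : MeromorphicAt (f ∘ (· - x k)) z₀ :=
    meromorphicAt_comp_sub_const_iff_meromorphicAt.2 (meromorphic_halfRoot _)
  have hsum : AnalyticAt ℂ (fun z => ∑ j ∈ (Finset.univ.erase i).erase k,
      f (x j - z) * weightExcept f j i x) z₀ :=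
    Finset.analyticAt_fun_sum _ fun l hl => (hfa' l (hother' l hl)).mul analyticAt_const
  rw [hS2]
  refine le_trans (le_min ?_ hsum.meromorphicOrderAt_nonneg)
    (meromorphicOrderAt_add (hfm.mul hprod.meromorphicAt) hsum.meromorphicAt)
  rw [meromorphicOrderAt_mul hfm hprod.meromorphicAt,
    meromorphicOrderAt_comp_sub_const_eq_meromorphicOrderAt]
  calc (0 : WithTop ℤ) = -1 + 1 := rfl
    _ ≤ _ := add_le_add (neg_one_le_order_halfRoot _) (one_le_meromorphicOrderAt hprod hval)

lemma analyticAt_sum_weight {x : Fin n → ℂ} (i : Fin n)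
    (hx : ∀ j k, j ≠ k → x j - x k ∉ L.lattice) :
    AnalyticAt ℂ (fun z => ∑ j, weight (halfRoot M a) j (Function.update x i z)) (x i) := by
  refine Finset.analyticAt_fun_sum _ fun j _ => Finset.analyticAt_fun_prod _ fun k hk => ?_
  have hup : ∀ l, AnalyticAt ℂ (fun z => Function.update x i z l) (x i) := fun l => by
    rcases eq_or_ne l i with rfl | hl
    · simp only [Function.update_self]
      fun_prop
    · simpa [hl] using analyticAt_const
  refine AnalyticAt.fun_comp (f := fun z => Function.update x i z j - Function.update x i z k) ?_
    ((hup j).sub (hup k))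
  rw [Function.update_eq_self]
  exact h.analyticAt_halfRoot (hx j k (Finset.ne_of_mem_erase hk).symm)

/-- Moving `x_i` by `a` flips all `n - 1` (an odd number) factors of `w_i`, and exactly one factor
of every other weight. -/
lemma sum_weight_update_add (hn : Even n) {x : Fin n → ℂ} (i : Fin n)
    (hx : ∀ j k, j ≠ k → x j - x k ∉ L.lattice) :
    ∑ j, weight (halfRoot M a) j (Function.update x i (x i + a)) =
      -∑ j, weight (halfRoot M a) j x := by
  rw [← Finset.sum_neg_distrib]
  refine Finset.sum_congr rfl fun j _ => ?_
  rcases eq_or_ne j i with rfl | hj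
  · rw [weight_update_self]
    have : ∀ k ∈ Finset.univ.erase j, halfRoot M a (x j + a - x k) =
        -1 * halfRoot M a (x j - x k) := fun k hk => by
      rw [add_sub_right_comm, h.halfRoot_add (hx j k (Finset.ne_of_mem_erase hk).symm), neg_one_mul]
    rw [Finset.prod_congr rfl this, Finset.prod_mul_distrib, Finset.prod_const,
      Finset.card_erase_of_mem (Finset.mem_univ j), Finset.card_univ, Fintype.card_fin]
    have hodd : Odd (n - 1) := by
      obtain ⟨m, rfl⟩ := hn
      have := j.pos
      exact ⟨m - 1, by omega⟩
    rw [hodd.neg_one_pow, neg_one_mul, weight]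
  · have hji := hx j i hj
    have hne : x j - (x i + a) ∉ L.lattice := fun hmem => hji (by
      rw [show x j - x i = (x j - (x i + a)) + a by ring]
      exact add_mem hmem h.mem)
    have := h.halfRoot_add hne
    rw [show x j - (x i + a) + a = x j - x i by ring] at this
    rw [weight_update_of_ne _ hj.symm, weight_eq_mul_weightExcept _ hj.symm, this]
    ring

theorem sum_weight_halfRoot (hn : Even n) {x : Fin n → ℂ}
    (hx : ∀ j k, j ≠ k → x j - x k ∉ L.lattice) : ∑ j, weight (halfRoot M a) j x = 0 := by
  rcases isEmpty_or_nonempty (Fin n) with hempty | ⟨⟨i⟩⟩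
  · simp
  have hm : Meromorphic (fun z => ∑ j, weight (halfRoot M a) j (Function.update x i z)) := by
    refine fun z => MeromorphicAt.fun_sum fun j _ => MeromorphicAt.fun_prod fun k hk => ?_
    rcases eq_or_ne j i with rfl | hj
    · have hki := Finset.ne_of_mem_erase hk
      simp only [Function.update_self, Function.update_of_ne hki]
      exact (meromorphic_halfRoot _).comp_analyticAt (g := fun z => z - x k) (by fun_prop)
    rcases eq_or_ne k i with rfl | hki
    · simp only [Function.update_self, Function.update_of_ne hj]
      exact (meromorphic_halfRoot _).comp_analyticAt (g := fun z => x j - z) (by fun_prop)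
    · simp only [Function.update_of_ne hki, Function.update_of_ne hj]
      exact MeromorphicAt.const _ _
  obtain ⟨c, hc⟩ := exists_eq_const_of_periodic M hm
    (h.order_sum_weight_nonneg hn fun j k hjk _ _ => hx j k hjk) (fun z l hl => by
      refine Finset.sum_congr rfl fun j _ => ?_
      rcases eq_or_ne j i with rfl | hj
      · simp only [weight_update_self, add_sub_right_comm z l, halfRoot_add_mem hl]
      · simp only [weight_update_of_ne _ hj.symm]
        rw [← halfRoot_add_mem hl (x j - (z + l)), show x j - (z + l) + l = x j - z by ring])
  have h1 := hc _ (h.analyticAt_sum_weight i hx).continuousAt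
  set y := Function.update x i (x i + a) with hy
  have hyL : ∀ j k, j ≠ k → y j - y k ∉ L.lattice := by
    intro j k hjk
    rcases eq_or_ne j i with rfl | hj
    · rw [hy, Function.update_self, Function.update_of_ne hjk.symm]
      exact fun hmem => hx j k hjk (by
        rw [show x j - x k = (x j + a - x k) - a by ring]
        exact sub_mem hmem h.mem)
    rcases eq_or_ne k i with rfl | hki
    · rw [hy, Function.update_self, Function.update_of_ne hj]
      exact fun hmem => hx j k hjk (by
        rw [show x j - x k = (x j - (x k + a)) + a by ring]
        exact add_mem hmem h.mem)
    · rw [hy, Function.update_of_ne hj, Function.update_of_ne hki]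
      exact hx j k hjk
  have h2 := (h.analyticAt_sum_weight i hyL).continuousAt
  simp only [hy, Function.update_idem, Function.update_self] at h2
  have h3 := hc _ h2
  rw [h.sum_weight_update_add hn i hx] at h3
  rw [Function.update_eq_self] at h1
  rw [h1] at h3 ⊢
  exact CharZero.neg_eq_self_iff.1 h3

end IsIndexTwo

end HalfPeriod

/-! ### An index-two sublattice containing the period `2w` -/

section Sublattice

lemma exists_isIndexTwo_of_basis (L : PeriodPair) {α β : ℂ}
    (hind : LinearIndependent ℝ ![α, β])
    (hL : ∀ z, z ∈ L.lattice ↔ ∃ m n : ℤ, m * α + n * β = z) {w : ℂ} {m n : ℤ}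
    (hw : m * α + n * (2 * β) = 2 * w) :
    ∃ (M : PeriodPair) (a : ℂ), IsIndexTwo M L a ∧ 2 * w ∈ M.lattice := by
  have hpair := LinearIndependent.pair_iff.1 hind
  let M : PeriodPair := ⟨α, 2 * β, LinearIndependent.pair_iff.2 fun s t hst => by
    have := hpair s (2 * t) (by
      simp only [Complex.real_smul] at hst ⊢
      push_cast
      linear_combination hst)
    exact ⟨this.1, by linarith [this.2]⟩⟩
  have hM : ∀ z, z ∈ M.lattice ↔ ∃ m n : ℤ, m * α + n * (2 * β) = z := fun z =>
    PeriodPair.mem_lattice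
  refine ⟨M, β, ⟨?_, ?_, ?_, ?_⟩, (hM _).2 ⟨m, n, hw⟩⟩
  · intro z hz
    obtain ⟨p, q, rfl⟩ := (hM z).1 hz
    exact (hL _).2 ⟨p, 2 * q, by push_cast; ring⟩
  · exact (hL _).2 ⟨0, 1, by simp⟩
  · intro hβ
    obtain ⟨p, q, hpq⟩ := (hM _).1 hβ
    have := (hpair p (2 * q - 1) (by
      simp only [Complex.real_smul]
      push_cast
      linear_combination hpq)).2
    have h2 : 2 * q - 1 = 0 := by exact_mod_cast this
    omega
  · intro l hl
    obtain ⟨p, q, rfl⟩ := (hL l).1 hl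
    rcases Int.even_or_odd' q with ⟨r, rfl | rfl⟩
    · exact Or.inl ((hM _).2 ⟨p, r, by push_cast; ring⟩)
    · exact Or.inr ((hM _).2 ⟨p, r, by push_cast; ring⟩)

/-- A basis is needed in which the second coordinate of `2w` is even; that basis vector is then
doubled. If both coordinates `m`, `n` are odd, the basis `ω₁ + ω₂, ω₂` gives coordinates `m`, `n -
m`. -/
lemma exists_isIndexTwo (L : PeriodPair) {w : ℂ} (h2w : 2 * w ∈ L.lattice) :
    ∃ (M : PeriodPair) (a : ℂ), IsIndexTwo M L a ∧ 2 * w ∈ M.lattice := by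
  have hpair := LinearIndependent.pair_iff.1 L.indep
  obtain ⟨m, n, hmn⟩ := PeriodPair.mem_lattice.1 h2w
  rcases Int.even_or_odd' n with ⟨k, rfl | rfl⟩
  · exact exists_isIndexTwo_of_basis L L.indep (fun z => PeriodPair.mem_lattice) (m := m) (n := k)
      (by push_cast at hmn; linear_combination hmn)
  rcases Int.even_or_odd' m with ⟨j, rfl | rfl⟩
  · refine exists_isIndexTwo_of_basis L (α := L.ω₂) (β := L.ω₁)
      (LinearIndependent.pair_iff.2 fun s t hst => ?_) (fun z => ?_) (m := 2 * k + 1) (n := j)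
      (by push_cast at hmn ⊢; linear_combination hmn)
    · exact (hpair t s (by rw [add_comm]; exact hst)).symm
    · rw [PeriodPair.mem_lattice]
      exact ⟨fun ⟨p, q, h⟩ => ⟨q, p, by rw [add_comm]; exact h⟩,
        fun ⟨p, q, h⟩ => ⟨q, p, by rw [add_comm]; exact h⟩⟩
  · refine exists_isIndexTwo_of_basis L (α := L.ω₁ + L.ω₂) (β := L.ω₂)
      (LinearIndependent.pair_iff.2 fun s t hst => ?_) (fun z => ?_) (m := 2 * j + 1) (n := k - j)
      (by push_cast at hmn ⊢; linear_combination hmn)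
    · have := hpair s (s + t) (by
        simp only [Complex.real_smul] at hst ⊢
        push_cast
        linear_combination hst)
      exact ⟨this.1, by linarith [this.1, this.2]⟩
    · rw [PeriodPair.mem_lattice]
      exact ⟨fun ⟨p, q, h⟩ => ⟨p, q - p, by push_cast; linear_combination h⟩,
        fun ⟨p, q, h⟩ => ⟨p, p + q, by push_cast; linear_combination h⟩⟩

end Sublattice

/-! ### Arbitrary meromorphic square roots, real and complex at once -/

section SquareRoots

variable {𝕜 : Type*} [RCLike 𝕜] [NormedAlgebra 𝕜 ℂ] {f : 𝕜 → 𝕜} {L M : PeriodPair} {a w : ℂ}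

lemma analyticAt_algebraMap (x : 𝕜) : AnalyticAt 𝕜 (algebraMap 𝕜 ℂ) x :=
  (algebraMapCLM 𝕜 ℂ).analyticAt x

lemma tendsto_algebraMap_nhdsNE (x : 𝕜) :
    Tendsto (algebraMap 𝕜 ℂ) (𝓝[≠] x) (𝓝[≠] (algebraMap 𝕜 ℂ x)) :=
  tendsto_nhdsNE_of_injective (analyticAt_algebraMap x).continuousAt (algebraMap 𝕜 ℂ).injective

/-- At a lattice point `℘` tends to infinity, while continuity of `f` would keep `f² + ℘(w)` bounded
nearby. -/
lemma notMem_lattice_of_continuousAt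
    (hsq : ∀ x : 𝕜, algebraMap 𝕜 ℂ x ∉ L.lattice →
      algebraMap 𝕜 ℂ (f x) ^ 2 = L.weierstrassP (algebraMap 𝕜 ℂ x) - L.weierstrassP w)
    {x : 𝕜} (hx : ContinuousAt f x) : algebraMap 𝕜 ℂ x ∉ L.lattice := by
  intro hmem
  have h1 : Tendsto (L.weierstrassP ∘ algebraMap 𝕜 ℂ) (𝓝[≠] x) (Bornology.cobounded ℂ) :=
    (tendsto_cobounded_of_meromorphicOrderAt_neg
      (by rw [L.order_weierstrassP _ hmem]; decide)).comp (tendsto_algebraMap_nhdsNE x)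
  have h2 : Tendsto (fun y => algebraMap 𝕜 ℂ (f y) ^ 2 + L.weierstrassP w) (𝓝[≠] x)
      (𝓝 (algebraMap 𝕜 ℂ (f x) ^ 2 + L.weierstrassP w)) := by
    have h3 : ContinuousAt (fun y => algebraMap 𝕜 ℂ (f y)) x :=
      (analyticAt_algebraMap (f x)).continuousAt.comp hx
    exact ((h3.pow 2).add continuousAt_const).tendsto.mono_left nhdsWithin_le_nhds
  refine h1.not_tendsto (Metric.disjoint_cobounded_nhds _) (h2.congr' ?_)
  filter_upwards [(tendsto_algebraMap_nhdsNE x).eventually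
    (eventually_notMem_lattice L _)] with y hy
  rw [hsq y hy, sub_add_cancel, Function.comp_apply]

/-- With `r` the restricted `halfRoot`, `(f - r)(f + r) = 0` near `0`. Orders add, so one factor
vanishes near `0` and hence at every regular point of `f`. The sum identity is homogeneous, so the
value of `ε` need not be recorded. -/
lemma exists_sign_eq_halfRoot (h : IsIndexTwo M L a) (hw : w ∉ L.lattice)
    (h2w : 2 * w ∈ M.lattice) (hf : Meromorphic f)
    (hsq : ∀ x : 𝕜, algebraMap 𝕜 ℂ x ∉ L.lattice →
      algebraMap 𝕜 ℂ (f x) ^ 2 = L.weierstrassP (algebraMap 𝕜 ℂ x) - L.weierstrassP w) :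
    ∃ ε : ℂ, ∀ x : 𝕜, AnalyticAt 𝕜 f x →
      algebraMap 𝕜 ℂ (f x) = ε * halfRoot M a (algebraMap 𝕜 ℂ x) := by
  set ι := algebraMap 𝕜 ℂ
  have hfm : Meromorphic (fun x => ι (f x)) := fun x => by
    simp only [ι, Algebra.algebraMap_eq_smul_one]
    exact (hf x).smul (MeromorphicAt.const (1 : ℂ) x)
  have hrm : Meromorphic (halfRoot M a ∘ ι) := fun x =>
    (meromorphic_halfRoot _).comp_analyticAt (analyticAt_algebraMap x)
  have hcont : ∀ x, AnalyticAt 𝕜 f x → ContinuousAt (fun x => ι (f x)) x ∧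
      ContinuousAt (halfRoot M a ∘ ι) x := fun x hx =>
    ⟨(analyticAt_algebraMap (f x)).continuousAt.comp hx.continuousAt,
      (h.analyticAt_halfRoot (notMem_lattice_of_continuousAt hsq hx.continuousAt)).continuousAt.comp
        (analyticAt_algebraMap x).continuousAt⟩
  have hprod : meromorphicOrderAt (((fun x => ι (f x)) - halfRoot M a ∘ ι) *
      ((fun x => ι (f x)) + halfRoot M a ∘ ι)) 0 = ⊤ := by
    rw [meromorphicOrderAt_eq_top_iff]
    filter_upwards [(tendsto_algebraMap_nhdsNE (0 : 𝕜)).eventually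
      (eventually_notMem_lattice L _)] with y hy
    have h1 := hsq y hy
    have h2 := h.halfRoot_sq hw h2w hy
    simp only [Pi.mul_apply, Pi.sub_apply, Pi.add_apply, Function.comp_apply]
    linear_combination h1 - h2
  rw [meromorphicOrderAt_mul ((hfm 0).sub (hrm 0)) ((hfm 0).add (hrm 0)),
    WithTop.add_eq_top, meromorphicOrderAt_eq_top_iff, meromorphicOrderAt_eq_top_iff] at hprod
  rcases hprod with h0 | h0
  · refine ⟨1, fun x hx => ?_⟩
    have := Meromorphic.eq_zero_of_eventually_eq_zero (Meromorphic.sub hfm hrm) h0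
      ((hcont x hx).1.sub (hcont x hx).2)
    rw [one_mul]
    exact sub_eq_zero.1 this
  · refine ⟨-1, fun x hx => ?_⟩
    have := Meromorphic.eq_zero_of_eventually_eq_zero (Meromorphic.add hfm hrm) h0
      ((hcont x hx).1.add (hcont x hx).2)
    rw [neg_one_mul]
    exact eq_neg_of_add_eq_zero_left this

theorem isOddSolution_sqrt_weierstrassP {n : ℕ} (hn : Even n) (h2w : 2 * w ∈ L.lattice)
    (hw : w ∉ L.lattice) (hf : Meromorphic f)
    (hsq : ∀ x : 𝕜, algebraMap 𝕜 ℂ x ∉ L.lattice →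
      algebraMap 𝕜 ℂ (f x) ^ 2 = L.weierstrassP (algebraMap 𝕜 ℂ x) - L.weierstrassP w) :
    IsOddSolution n f 0 := by
  obtain ⟨M, a, h, h2w'⟩ := exists_isIndexTwo L h2w
  obtain ⟨ε, hε⟩ := exists_sign_eq_halfRoot h hw h2w' hf hsq
  refine isOddSolution_of_odd hf (fun z hz hz' => ?_) fun x hx => ?_
  · apply (algebraMap 𝕜 ℂ).injective
    rw [hε _ hz', map_neg, map_neg, hε _ hz, halfRoot_neg, mul_neg]
  · apply (algebraMap 𝕜 ℂ).injective
    have hx' : ∀ j k, j ≠ k → algebraMap 𝕜 ℂ (x j) - algebraMap 𝕜 ℂ (x k) ∉ L.lattice := by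
      intro j k hjk
      rw [← map_sub]
      exact notMem_lattice_of_continuousAt hsq (hx j k hjk).continuousAt
    have hsum := h.sum_weight_halfRoot hn hx'
    have hterm : ∀ j, algebraMap 𝕜 ℂ (weight f j x) =
        ε ^ (n - 1) * weight (halfRoot M a) j (fun i => algebraMap 𝕜 ℂ (x i)) := by
      intro j
      have : ∀ k ∈ Finset.univ.erase j, algebraMap 𝕜 ℂ (f (x j - x k)) =
          ε * halfRoot M a (algebraMap 𝕜 ℂ (x j) - algebraMap 𝕜 ℂ (x k)) := fun k hk => by
        rw [hε _ (hx j k (Finset.ne_of_mem_erase hk).symm), map_sub]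
      rw [weight, weight, map_prod, Finset.prod_congr rfl this, Finset.prod_mul_distrib,
        Finset.prod_const, Finset.card_erase_of_mem (Finset.mem_univ j), Finset.card_univ,
        Fintype.card_fin]
    rw [map_sum, map_zero, Finset.sum_congr rfl fun j _ => hterm j, ← Finset.mul_sum, hsum, mul_zero]

end SquareRoots

end GalileiModel

theorem theorem3 (n : ℕ) (hn : 2 ≤ n) :
    -- the characterisation, for real and for complex phase space
    (∀ (𝕜 : Type) [RCLike 𝕜] (f : 𝕜 → 𝕜), Meromorphic f → ∀ c : 𝕜,
      (GalileiModel.SatisfiesAlgebra n f c ↔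
        (GalileiModel.IsEven f ∨ GalileiModel.IsOdd f) ∧ GalileiModel.SumIdentity n f c)) ∧
    -- `1 / x`
    GalileiModel.IsOddSolution n (fun x : ℝ => 1 / x) 0 ∧
    GalileiModel.IsOddSolution n (fun x : ℂ => 1 / x) 0 ∧
    -- `coth x`
    GalileiModel.IsOddSolution n (fun x : ℝ => Real.cosh x / Real.sinh x)
      (if Odd n then 1 else 0) ∧
    GalileiModel.IsOddSolution n (fun x : ℂ => Complex.cosh x / Complex.sinh x)
      (if Odd n then 1 else 0) ∧
    -- `√(℘ - e_α)`, where `e_α = ℘ w` for a half-period `w`: a meromorphic square root exists,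
    -- and for an even number of particles each one is an odd solution
    (∀ (L : PeriodPair) (w : ℂ), 2 * w ∈ L.lattice → w ∉ L.lattice →
      (∃ f : ℂ → ℂ, Meromorphic f ∧
        ∀ z ∉ L.lattice, f z ^ 2 = L.weierstrassP z - L.weierstrassP w) ∧
      (Even n →
        (∀ f : ℂ → ℂ, Meromorphic f →
          (∀ z ∉ L.lattice, f z ^ 2 = L.weierstrassP z - L.weierstrassP w) →
          GalileiModel.IsOddSolution n f 0) ∧
        (∀ f : ℝ → ℝ, Meromorphic f →
          (∀ x : ℝ, (x : ℂ) ∉ L.lattice →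
            ((f x ^ 2 : ℝ) : ℂ) = L.weierstrassP x - L.weierstrassP w) →
          GalileiModel.IsOddSolution n f 0))) := by
  refine ⟨fun 𝕜 _ f hf c => GalileiModel.satisfiesAlgebra_iff hn hf c,
    GalileiModel.isOddSolution_inv hn, GalileiModel.isOddSolution_inv hn,
    GalileiModel.isOddSolution_coth_real, GalileiModel.isOddSolution_coth_complex,
    fun L w h2w hw => ⟨?_, fun heven => ⟨fun f hf hsq => ?_, fun f hf hsq => ?_⟩⟩⟩
  · obtain ⟨M, a, h, h2w'⟩ := GalileiModel.exists_isIndexTwo L h2w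
    exact ⟨GalileiModel.halfRoot M a, GalileiModel.meromorphic_halfRoot,
      fun z hz => h.halfRoot_sq hw h2w' hz⟩
  · exact GalileiModel.isOddSolution_sqrt_weierstrassP (w := w) heven h2w hw hf hsq
  · refine GalileiModel.isOddSolution_sqrt_weierstrassP (w := w) heven h2w hw hf fun x hx => ?_
    simpa using hsq x hx
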